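/- Let $G$ be a compact connected simple Lie group with Lie algebra $\mathfrak g$, equipped with an invariant inner product $\langle\cdot,\cdot\rangle$. Let $\theta_1,\theta_2$ be commuting involutions (smooth automorphisms of order two) of $G$; denote their differentials on $\mathfrak g$ by the same symbols, and let $\mathfrak m_i=\{X\in\mathfrak g\mid\theta_i(X)=-X\}$. Let $\mathfrak a$ be a maximal abelian subspace of $\mathfrak m_1$, and suppose that $\theta_2=\tau_{\exp Y}\,\theta_1\,\tau_{\exp Y}^{-1}$ for some $Y\in\mathfrak a$, where $\tau_g(x)=gxg^{-1}$ (so $\theta_1$ and $\theta_2$ are conjugate by an inner automorphism). For $\alpha\in\mathfrak a$ and $\epsilon=\pm1$ put $$\mathfrak g(\mathfrak a,\alpha)=\{X\in\mathfrak g^{\mathbb C}\mid [H,X]=\sqrt{-1}\,\langle\alpha,H\rangle X\ (H\in\mathfrak a)\},\qquad \mathfrak g(\mathfrak a,\alpha,\epsilon)=\{X\in\mathfrak g(\mathfrak a,\alpha)\mid\theta_1\theta_2(X)=\epsilon X\}.$$ Let $\bar\Sigma=\{\lambda\in\mathfrak a\setminus\{0\}\mid\mathfrak g(\mathfrak a,\lambda)\ne0\}$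 be the restricted root system of $(G,\theta_1)$, with multiplicities $\bar m_\lambda=\dim_{\mathbb C}\mathfrak g(\mathfrak a,\lambda)$. Let $(\tilde\Sigma,\Sigma,W;m,n)$ be the data constructed from $(G,\theta_1,\theta_2)$ and $\mathfrak a$: $$\tilde\Sigma=\{\alpha\in\mathfrak a\setminus\{0\}\mid\mathfrak g(\mathfrak a,\alpha)\neq0\},\quad \Sigma=\{\alpha\in\tilde\Sigma\mid\mathfrak g(\mathfrak a,\alpha,1)\ne0\},\quad W=\{\alpha\in\tilde\Sigma\mid\mathfrak g(\mathfrak a,\alpha,-1)\ne0\},$$ $$m(\alpha)=\dim_{\mathbb C}\mathfrak g(\mathfrak a,\alpha,1),\qquad n(\alpha)=\dim_{\mathbb C}\mathfrak g(\mathfrak a,\alpha,-1).$$ Then $\mathfrak a$ is a maximal abelian subspace of $\mathfrak m_1\cap\mathfrak m_2$; $Y$ lies in the lattice $\Gamma=\{X\in\mathfrak a\mid\langle\lambda,X\rangle\in\tfrac{\pi}{2}\mathbb Z\ (\lambda\in\bar\Sigma)\}$; and $(\tilde\Sigma,\Sigma,W;m,n)$ is the symmetric triad of type (IV) with multiplicities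 of $\mathfrak a$ with base $(\bar\Sigma;\bar m)$ determined by $Y$. That is: 1. $\bar\Sigma$ is an irreducible (nonempty, possibly non-reduced) root system of $\mathfrak a$, and $\bar m$ is positive on $\bar\Sigma$ and satisfies $\bar m_{w_\alpha\beta}=\bar m_\beta$ for $\alpha,\beta\in\bar\Sigma$, where $w_\alpha$ is the reflection in $\alpha$; 2. $\tilde\Sigma=\bar\Sigma$, $\ \Sigma=\Sigma_Y:=\{\lambda\in\bar\Sigma\mid\langle\lambda,2Y\rangle\in2\pi\mathbb Z\}$, and $W=W_Y:=\{\lambda\in\bar\Sigma\mid\langle\lambda,2Y\rangle\in\pi+2\pi\mathbb Z\}=\bar\Sigma\setminus\Sigma_Y$; 3. $(m(\lambda),n(\lambda))=(\bar m_\lambda,0)$ for $\lambda\in\Sigma_Y$, and $(m(\lambda),n(\lambda))=(0,\bar m_\lambda)$ for $\lambda\in W_Y$. In particular, if $Y=0$, then $\theta_1=\theta_2$ and $(\tilde\Sigma,\Sigma,W)=(\bar\Sigma,\bar\Sigma,\emptyset)$. -/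

import Mathlib

open scoped Manifold ContDiff TensorProduct

namespace SymTriad

/-! ### Root systems and triads of type (IV), inside a subspace `a` of a real vector space `V`

The inner product is an explicit bilinear form `B` on `V`; roots are vectors of `a`. -/

section RootSystems

variable {V : Type*} [AddCommGroup V] [Module ℝ V]

/-- `B` is a (positive definite, symmetric) inner product on `V`. -/
structure IsInnerProduct (B : LinearMap.BilinForm ℝ V) : Prop where
  symm : ∀ x y, B x y = B y x
  pos : ∀ x, x ≠ 0 → 0 < B x x

/-- The reflection `w_α(H) = H - 2 (⟨α, H⟩ / ‖α‖²) α`. -/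
noncomputable def reflection (B : LinearMap.BilinForm ℝ V) (α H : V) : V :=
  H - (2 * B α H / B α α) • α

/-- `Δ` is a (possibly non-reduced) root system of the subspace `a` with inner product `B`. -/
structure IsRootSystem (B : LinearMap.BilinForm ℝ V) (a : Submodule ℝ V) (Δ : Set V) : Prop where
  finite : Δ.Finite
  zero_notMem : (0 : V) ∉ Δ
  span_eq : Submodule.span ℝ Δ = a
  reflection_mem : ∀ α ∈ Δ, ∀ β ∈ Δ, reflection B α β ∈ Δ
  integral : ∀ α ∈ Δ, ∀ β ∈ Δ, ∃ k : ℤ, 2 * B α β / B α α = k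

/-- `Δ` is a disjoint union of two nonempty mutually orthogonal subsets. -/
def IsReducible (B : LinearMap.BilinForm ℝ V) (Δ : Set V) : Prop :=
  ∃ Δ₁ Δ₂ : Set V, Δ₁.Nonempty ∧ Δ₂.Nonempty ∧ Δ = Δ₁ ∪ Δ₂ ∧ Δ₁ ∩ Δ₂ = ∅ ∧
    ∀ α ∈ Δ₁, ∀ β ∈ Δ₂, B α β = 0

/-- `Δ` is an irreducible root system of `a`. -/
structure IsIrreducibleRootSystem (B : LinearMap.BilinForm ℝ V) (a : Submodule ℝ V)
    (Δ : Set V) : Prop where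
  isRootSystem : IsRootSystem B a Δ
  nonempty : Δ.Nonempty
  not_reducible : ¬ IsReducible B Δ

/-- `m` is a multiplicity on the root system `Δ`: positive, and invariant under the reflections
in the roots.  Only the values of `m` on `Δ` are relevant. -/
structure IsRootMultiplicity (B : LinearMap.BilinForm ℝ V) (Δ : Set V) (m : V → ℝ) : Prop where
  pos : ∀ α ∈ Δ, 0 < m α
  reflection_eq : ∀ α ∈ Δ, ∀ β ∈ Δ, m (reflection B α β) = m β

/-- The lattice `Γ = {X ∈ a | ⟨λ, X⟩ ∈ (π/2)ℤ for all λ ∈ Δ}`. -/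
def latticeΓ (B : LinearMap.BilinForm ℝ V) (a : Submodule ℝ V) (Δ : Set V) : Set V :=
  {X | X ∈ a ∧ ∀ l ∈ Δ, ∃ k : ℤ, B l X = Real.pi / 2 * k}

/-- `Σ_Y = {λ ∈ Δ | ⟨λ, 2Y⟩ ∈ 2πℤ}`. -/
def sigmaAt (B : LinearMap.BilinForm ℝ V) (Δ : Set V) (Y : V) : Set V :=
  {l | l ∈ Δ ∧ ∃ k : ℤ, B l ((2 : ℝ) • Y) = 2 * Real.pi * k}

/-- `W_Y = {λ ∈ Δ | ⟨λ, 2Y⟩ ∈ π + 2πℤ}`. -/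
def wAt (B : LinearMap.BilinForm ℝ V) (Δ : Set V) (Y : V) : Set V :=
  {l | l ∈ Δ ∧ ∃ k : ℤ, B l ((2 : ℝ) • Y) = Real.pi + 2 * Real.pi * k}

/-- The data `(Σ̃, Σ, W; m, n)`.  Only the values of `m` and `n` on `Σ̃` are relevant. -/
structure Triad (V : Type*) where
  tildeSigma : Set V
  sigma : Set V
  w : Set V
  m : V → ℝ
  n : V → ℝ

/-- `T = (Σ̃, Σ, W; m, n)` is the symmetric triad of type (IV) with multiplicities of `a` which is
determined by the base `(Δ; mult)` and the element `Y` of the lattice `Γ` of `Δ`. -/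
structure IsTypeIVWith (B : LinearMap.BilinForm ℝ V) (a : Submodule ℝ V) (T : Triad V)
    (Δ : Set V) (mult : V → ℝ) (Y : V) : Prop where
  irreducible : IsIrreducibleRootSystem B a Δ
  isMultiplicity : IsRootMultiplicity B Δ mult
  mem_lattice : Y ∈ latticeΓ B a Δ
  tildeSigma_eq : T.tildeSigma = Δ
  sigma_eq : T.sigma = sigmaAt B Δ Y
  w_eq : T.w = wAt B Δ Y
  w_eq_diff : T.w = Δ \ sigmaAt B Δ Y
  m_sigma : ∀ l ∈ T.sigma, T.m l = mult l
  n_sigma : ∀ l ∈ T.sigma, T.n l = 0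
  m_w : ∀ l ∈ T.w, T.m l = 0
  n_w : ∀ l ∈ T.w, T.n l = mult l

/-- `T` is a symmetric triad of type (IV) with multiplicities of `a`. -/
def IsTypeIV (B : LinearMap.BilinForm ℝ V) (a : Submodule ℝ V) (T : Triad V) : Prop :=
  ∃ (mult : V → ℝ) (Y : V), IsTypeIVWith B a T T.tildeSigma mult Y

end RootSystems

/-! ### The constructions from a real Lie algebra with involutions -/

section LieAlgebras

variable {g : Type*} [LieRing g] [LieAlgebra ℝ g]

/-- `B` is an invariant inner product on the Lie algebra `g`: all `ad X` are skew-symmetric. -/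
structure IsInvariantInnerProduct (B : LinearMap.BilinForm ℝ g) : Prop where
  isInnerProduct : IsInnerProduct B
  invariant : ∀ X Y Z : g, B ⁅X, Y⁆ Z = - B Y ⁅X, Z⁆

/-- The `(-1)`-eigenspace `m` of an involution of `g`. -/
def minusPart (t : g →ₗ[ℝ] g) : Submodule ℝ g :=
  Module.End.eigenspace t (-1)

/-- `a` is a maximal abelian subspace of `p`. -/
def IsMaximalAbelian (p a : Submodule ℝ g) : Prop :=
  Maximal (fun b : Submodule ℝ g => b ≤ p ∧ ∀ X ∈ b, ∀ Y ∈ b, ⁅X, Y⁆ = 0) a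

/-- `g(a, α) = {X ∈ g^ℂ | [H, X] = √-1 ⟨α, H⟩ X for all H ∈ a}`. -/
noncomputable def rootSpace (B : LinearMap.BilinForm ℝ g) (a : Submodule ℝ g) (α : g) :
    Submodule ℂ (ℂ ⊗[ℝ] g) where
  carrier := {X | ∀ H ∈ a, LieAlgebra.ad ℂ (ℂ ⊗[ℝ] g) ((1 : ℂ) ⊗ₜ[ℝ] H) X =
    (Complex.I * (B α H : ℂ)) • X}
  add_mem' := by
    intro X Y hX hY H hH
    rw [map_add, hX H hH, hY H hH, smul_add]
  zero_mem' := by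
    intro H _
    rw [map_zero, smul_zero]
  smul_mem' := by
    intro c X hX H hH
    rw [map_smul, hX H hH, smul_comm]

/-- `g(a, α, ε) = {X ∈ g(a, α) | t X = ε X}`, for the complex-linear extension of `t`. -/
noncomputable def rootSpaceEps (B : LinearMap.BilinForm ℝ g) (a : Submodule ℝ g)
    (t : g →ₗ[ℝ] g) (α : g) (ε : ℂ) : Submodule ℂ (ℂ ⊗[ℝ] g) :=
  rootSpace B a α ⊓ Module.End.eigenspace (t.baseChange ℂ) ε

/-- The restricted roots with respect to `a`: the nonzero `α ∈ a` with `g(a, α) ≠ 0`. -/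
def restrictedRoots (B : LinearMap.BilinForm ℝ g) (a : Submodule ℝ g) : Set g :=
  {α | α ∈ a ∧ α ≠ 0 ∧ rootSpace B a α ≠ ⊥}

/-- The multiplicity of a restricted root `α`: the complex dimension of `g(a, α)`. -/
noncomputable def restrictedMult (B : LinearMap.BilinForm ℝ g) (a : Submodule ℝ g) (α : g) : ℝ :=
  (Module.finrank ℂ (rootSpace B a α) : ℝ)

/-- The data `(Σ̃, Σ, W; m, n)` constructed from the involutions `t₁`, `t₂` of `g` and `a`. -/
noncomputable def triadOf (B : LinearMap.BilinForm ℝ g) (a : Submodule ℝ g)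
    (t₁ t₂ : g →ₗ[ℝ] g) : Triad g where
  tildeSigma := {α | α ∈ a ∧ α ≠ 0 ∧ rootSpace B a α ≠ ⊥}
  sigma := {α | α ∈ a ∧ α ≠ 0 ∧ rootSpace B a α ≠ ⊥ ∧ rootSpaceEps B a (t₁ ∘ₗ t₂) α 1 ≠ ⊥}
  w := {α | α ∈ a ∧ α ≠ 0 ∧ rootSpace B a α ≠ ⊥ ∧ rootSpaceEps B a (t₁ ∘ₗ t₂) α (-1) ≠ ⊥}
  m α := (Module.finrank ℂ (rootSpaceEps B a (t₁ ∘ₗ t₂) α 1) : ℝ)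
  n α := (Module.finrank ℂ (rootSpaceEps B a (t₁ ∘ₗ t₂) α (-1)) : ℝ)

end LieAlgebras

/-! ### Lie groups -/

section LieGroups

/-- A smooth real Lie group is smooth enough for its Lie algebra to be defined. -/
instance : ENat.LEInfty (minSmoothness ℝ 3) :=
  ⟨by rw [minSmoothness_of_isRCLikeNormedField]; exact ENat.LEInfty.out⟩

variable {E : Type*} [NormedAddCommGroup E] [NormedSpace ℝ E]
  {G : Type*} [TopologicalSpace G] [ChartedSpace E G] [Group G] [LieGroup 𝓘(ℝ, E) ∞ G]

variable (E) in
/-- An involution of the Lie group `G`: a smooth automorphism of order two. -/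
structure IsInvolution (t : MulAut G) : Prop where
  contMDiff : ContMDiff 𝓘(ℝ, E) 𝓘(ℝ, E) ∞ (fun x : G => t x)
  mul_self : t * t = 1
  ne_one : t ≠ 1

variable (E) in
/-- The differential at the identity of an automorphism `t` of `G`, as a linear map of the Lie
algebra of `G` to itself (recall that `t 1 = 1`). -/
noncomputable def differential (t : MulAut G) :
    GroupLieAlgebra 𝓘(ℝ, E) G →ₗ[ℝ] GroupLieAlgebra 𝓘(ℝ, E) G :=
  (show GroupLieAlgebra 𝓘(ℝ, E) G →L[ℝ] GroupLieAlgebra 𝓘(ℝ, E) G from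
    mfderiv 𝓘(ℝ, E) 𝓘(ℝ, E) (fun x : G => t x) (1 : G)).toLinearMap

/-- `y = exp X`: there is a smooth one-parameter subgroup `c` of `G` with velocity `X` at `0` and
`c 1 = y`. -/
def IsExp (X : GroupLieAlgebra 𝓘(ℝ, E) G) (y : G) : Prop :=
  ∃ c : ℝ → G, ContMDiff 𝓘(ℝ, ℝ) 𝓘(ℝ, E) ∞ c ∧ (∀ s t : ℝ, c (s + t) = c s * c t) ∧
    (mfderiv 𝓘(ℝ, ℝ) 𝓘(ℝ, E) c 0 (1 : ℝ) : E) = X ∧ c 1 = y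

end LieGroups

end SymTriad

open SymTriad

/-! ### One-parameter groups of operators -/

section LinearFlows

variable {V : Type*} [NormedAddCommGroup V] [NormedSpace ℝ V]

/-! Let `R = Ad (exp Y) = exp (ad Y)`, so that `t₂ = R t₁ R⁻¹` on the Lie algebra. Since `t₁ Y =
-Y`, conjugation by `t₁` inverts `R`, hence `t₁ t₂ = R⁻² = exp (-2 ad Y)`. On the root space of `α`
this is the scalar `exp (-2i⟨α, Y⟩)` (`comp_apply_of_mem_rootSpace`). The involutions commute, so
the scalar squares to one. This puts `Y` in the lattice `Γ`, and each root space lies wholly in the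
`1`- or wholly in the `(-1)`-eigenspace of `t₁ t₂`, according to the parity of `2⟨α, Y⟩/π`. As `R`
fixes `a` pointwise, `a` also lies in the `(-1)`-eigenspace of `t₂`.

It remains to see that the restricted roots form an irreducible root system with invariant
multiplicities. The operators `ad H`, `H ∈ a`, commute and are skew, which gives the root space
decomposition (`iSup_rootSpace`). Root vectors `S`, `T` produce an automorphism `exp (ad X)` that
acts on `a` as the reflection (`exists_weyl`). Integrality comes from quaternion-like relations
between two such exponentials (`pow_four_eq_one`), and irreducibility from the simplicity of the
algebra (`not_isReducible`).

On the group side, `Ad (exp sY)` must be shown to rotate planes as `exp (s ad Y)` does. For this the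
derivative of `Ad` is computed from the second derivative of the multiplication in a chart
(`lie_eq_chart`, `hasDerivAt_adjointCLM`). Connectedness of `G` ensures that an automorphism is
determined by its differential. -/

theorem constant_of_hasDerivAt_zero {f : ℝ → V} (hf : ∀ s, HasDerivAt f 0 s) (s t : ℝ) :
    f s = f t :=
  is_const_of_deriv_eq_zero (fun s => (hf s).differentiableAt) (fun s => (hf s).deriv) s t

/-- A curve of operators `F` with `F' = F ∘ A = A ∘ F`, applied to vectors rotated by `A`. -/
theorem flow_rotation {F : ℝ → V →L[ℝ] V} {A : V →L[ℝ] V}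
    (hF : ∀ s, HasDerivAt F (F s * A) s) (h0 : F 0 = 1) {u v : V} {c : ℝ}
    (hu : A u = -(c • v)) (hv : A v = c • u) (s : ℝ) :
    F s (Real.cos (s * c) • u + Real.sin (s * c) • v) = u ∧
      F s (-(Real.sin (s * c) • u) + Real.cos (s * c) • v) = v := by
  have hc : ∀ s : ℝ, HasDerivAt (fun s => Real.cos (s * c)) (-Real.sin (s * c) * c) s := fun s => by
    simpa using ((hasDerivAt_id s).mul_const c).cos
  have hs : ∀ s : ℝ, HasDerivAt (fun s => Real.sin (s * c)) (Real.cos (s * c) * c) s := fun s => by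
    simpa using ((hasDerivAt_id s).mul_const c).sin
  constructor
  -- The rotated vector `x s` satisfies `x' = -A x`, so the derivative of `F s (x s)` cancels.
  · have key := constant_of_hasDerivAt_zero
      (f := fun s => F s (Real.cos (s * c) • u + Real.sin (s * c) • v)) (fun s => by
        have h := (hF s).clm_apply (((hc s).smul_const u).add ((hs s).smul_const v))
        refine h.congr_deriv ?_
        simp only [mul_apply_eq_comp, Pi.add_apply, 
          map_add, map_smul, hu, hv, map_neg]
        module) s 0
    simpa [h0] using key
  · have key := constant_of_hasDerivAt_zero
      (f := fun s => F s (-(Real.sin (s * c) • u) + Real.cos (s * c) • v)) (fun s => by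
        have h := (hF s).clm_apply (((hs s).smul_const u).neg.add ((hc s).smul_const v))
        refine h.congr_deriv ?_
        simp only [mul_apply_eq_comp, Pi.add_apply, Pi.neg_apply,
          map_add, map_smul, hu, hv, map_neg]
        module) s 0
    simpa [h0] using key

/-- Writing `F t = F s * F (t - s)` moves the derivative at `0` to any `s`. -/
theorem hasDerivAt_of_add_eq_mul {F : ℝ → V →L[ℝ] V} {A : V →L[ℝ] V}
    (hF : HasDerivAt F A 0) (hadd : ∀ s t, F (s + t) = F s * F t) (s : ℝ) :
    HasDerivAt F (F s * A) s := by
  have h1 : HasDerivAt (fun t => F (t - s)) A s := by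
    have := HasDerivAt.comp_sub_const s s (f := F) (f' := A) (by simpa using hF)
    simpa using this
  have h2 := h1.const_mul (F s)
  refine h2.congr_of_eventuallyEq (Filter.Eventually.of_forall fun t => ?_)
  simp only [← hadd]
  congr 1
  ring

/-- One-parameter groups rotate the planes which their generator rotates. -/
theorem oneParameterGroup_rotation {F : ℝ → V →L[ℝ] V} {A : V →L[ℝ] V}
    (hF : HasDerivAt F A 0) (hadd : ∀ s t, F (s + t) = F s * F t) (h0 : F 0 = 1)
    {u v : V} {c : ℝ} (hu : A u = -(c • v)) (hv : A v = c • u) (s : ℝ) :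
    F s u = Real.cos (s * c) • u - Real.sin (s * c) • v ∧
      F s v = Real.sin (s * c) • u + Real.cos (s * c) • v := by
  -- At time `-s` this writes `u` and `v` as images under `F (-s)`, which `F s` undoes.
  obtain ⟨h1, h2⟩ := flow_rotation (hasDerivAt_of_add_eq_mul hF hadd) h0 hu hv (-s)
  have hinv : ∀ x, F s (F (-s) x) = x := fun x => by
    rw [← mul_apply_eq_comp, ← hadd, add_neg_cancel, h0]; rfl
  constructor
  · conv_lhs => rw [← h1, hinv]
    simp [sub_eq_add_neg]
  · conv_lhs => rw [← h2, hinv]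
    simp

end LinearFlows

/-! ### The exponential of an endomorphism, transported from coordinates -/

section ExpEnd

variable {W : Type*} [NormedAddCommGroup W] [NormedSpace ℝ W] [CompleteSpace W]

theorem hasDerivAt_exp_smul (A : W →L[ℝ] W) (s : ℝ) :
    HasDerivAt (fun s : ℝ => NormedSpace.exp (s • A)) (NormedSpace.exp (s • A) * A) s :=
  hasDerivAt_exp_smul_const A s

theorem exp_smul_add (A : W →L[ℝ] W) (s t : ℝ) :
    NormedSpace.exp ((s + t) • A) = NormedSpace.exp (s • A) * NormedSpace.exp (t • A) := by
  let : NormedAlgebra ℚ (W →L[ℝ] W) := NormedAlgebra.restrictScalars ℚ ℝ _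
  rw [add_smul]
  exact NormedSpace.exp_add_of_commute (((Commute.refl A).smul_left s).smul_right t)

theorem exp_neg_mul_exp (A : W →L[ℝ] W) : NormedSpace.exp (-A) * NormedSpace.exp A = 1 := by
  let : NormedAlgebra ℚ (W →L[ℝ] W) := NormedAlgebra.restrictScalars ℚ ℝ _
  rw [← NormedSpace.exp_add_of_commute (Commute.neg_left (Commute.refl A)), neg_add_cancel,
    NormedSpace.exp_zero]

/-- The curve `exp (s A') P exp (-s A)` has zero derivative; its values at `s = 1` and `s = 0` are
compared. -/
theorem exp_semiconj {A A' P : W →L[ℝ] W} (h : P * A = A' * P) :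
    P * NormedSpace.exp A = NormedSpace.exp A' * P := by
  have hd : ∀ s : ℝ, HasDerivAt
      (fun s : ℝ => NormedSpace.exp (s • A') * P * NormedSpace.exp ((-s) • A)) 0 s := fun s => by
    have h1 := (hasDerivAt_exp_smul A' s).mul_const P
    have h2 := (hasDerivAt_exp_smul A (-s)).scomp s (hasDerivAt_neg s)
    refine (h1.mul h2).congr_deriv ?_
    have h3 : Commute (NormedSpace.exp ((-s) • A)) A :=
      (((Commute.refl A).smul_left (-s))).exp_left
    simp only [Function.comp_apply]
    rw [h3.eq]
    simp only [neg_smul, one_smul, mul_neg]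
    simp only [← mul_assoc]
    rw [mul_assoc _ P A, h, ← mul_assoc]
    simp
  have key := constant_of_hasDerivAt_zero hd 1 0
  simp only [one_smul, zero_smul, neg_zero, NormedSpace.exp_zero, one_mul, mul_one, neg_smul]
    at key
  conv_lhs => rw [← key]
  rw [mul_assoc, exp_neg_mul_exp, mul_one]

/-- A derivation exponentiates to an automorphism: `exp (-s A)` applied to the product of `exp (s A)
x` and `exp (s A) y` is constant in `s`. -/
theorem exp_leibniz {A : W →L[ℝ] W} (br : W →L[ℝ] W →L[ℝ] W)
    (h : ∀ x y, A (br x y) = br (A x) y + br x (A y)) (x y : W) :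
    NormedSpace.exp A (br x y) = br (NormedSpace.exp A x) (NormedSpace.exp A y) := by
  have hx : ∀ (x : W) (s : ℝ), HasDerivAt (fun s : ℝ => NormedSpace.exp (s • A) x)
      (A (NormedSpace.exp (s • A) x)) s := fun x s => by
    refine ((hasDerivAt_exp_smul A s).clm_apply (hasDerivAt_const s x)).congr_deriv ?_
    have h3 : Commute (NormedSpace.exp (s • A)) A := ((Commute.refl A).smul_left s).exp_left
    rw [h3.eq]
    simp
  have hd : ∀ s : ℝ, HasDerivAt (fun s : ℝ => NormedSpace.exp ((-s) • A)
      (br (NormedSpace.exp (s • A) x) (NormedSpace.exp (s • A) y))) 0 s := fun s => by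
    have h2 := (hasDerivAt_exp_smul A (-s)).scomp s (hasDerivAt_neg s)
    have h1 := ((br.hasFDerivAt.comp_hasDerivAt s (hx x s)).clm_apply (hx y s))
    refine (h2.clm_apply h1).congr_deriv ?_
    simp [h]
  have key := constant_of_hasDerivAt_zero hd 1 0
  simp only [one_smul, zero_smul, neg_zero, NormedSpace.exp_zero, neg_smul,
    one_apply_eq_self] at key
  have h4 : ∀ z, NormedSpace.exp A (NormedSpace.exp (-A) z) = z := fun z => by
    have := exp_neg_mul_exp (-A)
    rw [neg_neg] at this
    rw [← mul_apply_eq_comp, this, one_apply_eq_self]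
  conv_lhs => rw [← key]
  rw [h4]

variable {V : Type*} [AddCommGroup V] [Module ℝ V] [FiniteDimensional ℝ V]

variable (V) in
/-- Coordinates on a finite-dimensional real vector space. -/
noncomputable def coordEquiv : V ≃ₗ[ℝ] (Fin (Module.finrank ℝ V) → ℝ) :=
  (Module.finBasis ℝ V).equivFun

/-- An endomorphism of `V` in coordinates, as a continuous linear map. -/
noncomputable def coordCLM (A : Module.End ℝ V) :
    (Fin (Module.finrank ℝ V) → ℝ) →L[ℝ] (Fin (Module.finrank ℝ V) → ℝ) :=
  LinearMap.toContinuousLinearMap ((coordEquiv V).conj A)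

theorem coordCLM_apply (A : Module.End ℝ V) (x : Fin (Module.finrank ℝ V) → ℝ) :
    coordCLM A x = (coordEquiv V)
      (A ((coordEquiv V).symm x)) := rfl

/-- The exponential of an endomorphism of a finite-dimensional real vector space. -/
noncomputable def expEnd (A : Module.End ℝ V) : Module.End ℝ V :=
  (coordEquiv V).symm.conj (NormedSpace.exp (coordCLM A)).toLinearMap

theorem expEnd_apply (A : Module.End ℝ V) (x : V) :
    expEnd A x = (coordEquiv V).symm
      ((NormedSpace.exp (coordCLM A))
        ((coordEquiv V) x)) := rfl

theorem expEnd_semiconj {A A' P : Module.End ℝ V} (h : P * A = A' * P) :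
    P * expEnd A = expEnd A' * P := by
  set e := coordEquiv V
  have key := exp_semiconj (A := (coordCLM A))
    (A' := (coordCLM A')) (P := (coordCLM P)) (by
      refine ContinuousLinearMap.ext fun x => ?_
      have := congrArg e (LinearMap.congr_fun h (e.symm x))
      simpa [e, coordCLM_apply] using this)
  ext x
  have := congrArg e.symm (DFunLike.congr_fun key (e x))
  simpa [e, coordCLM_apply, expEnd_apply] using this

theorem expEnd_neg_mul (A : Module.End ℝ V) : expEnd (-A) * expEnd A = 1 := by
  set e := coordEquiv V
  have key := exp_neg_mul_exp (coordCLM A)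
  rw [show -coordCLM A = coordCLM (-A) by simp [coordCLM]] at key
  ext x
  have := congrArg e.symm (DFunLike.congr_fun key (e x))
  simpa [e, expEnd_apply] using this

theorem expEnd_leibniz {A : Module.End ℝ V} (br : V →ₗ[ℝ] V →ₗ[ℝ] V)
    (h : ∀ x y, A (br x y) = br (A x) y + br x (A y)) (x y : V) :
    expEnd A (br x y) = br (expEnd A x) (expEnd A y) := by
  set e := coordEquiv V
  let br' : (Fin (Module.finrank ℝ V) → ℝ) →L[ℝ] (Fin (Module.finrank ℝ V) → ℝ) →L[ℝ]
      (Fin (Module.finrank ℝ V) → ℝ) :=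
    (LinearMap.toContinuousLinearMap.toLinearMap ∘ₗ
      (br.compr₂ e.toLinearMap).compl₁₂ e.symm.toLinearMap e.symm.toLinearMap).toContinuousLinearMap
  have hbr : ∀ x y, br' x y = e (br (e.symm x) (e.symm y)) := fun x y => rfl
  have key := exp_leibniz (A := (coordCLM A)) br' (fun x y => by
    simp [e, hbr, coordCLM_apply, h]) (e x) (e y)
  have := congrArg e.symm key
  simpa [e, hbr, expEnd_apply] using this

theorem expEnd_rotation {A : Module.End ℝ V} {u v : V} {c : ℝ}
    (hu : A u = -(c • v)) (hv : A v = c • u) :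
    expEnd A u = Real.cos c • u - Real.sin c • v ∧
      expEnd A v = Real.sin c • u + Real.cos c • v := by
  set e := coordEquiv V
  have h0 := hasDerivAt_exp_smul (coordCLM A) 0
  obtain ⟨h1, h2⟩ := oneParameterGroup_rotation (A := coordCLM A) (u := e u) (v := e v) (c := c)
    (h0.congr_deriv (by simp)) (exp_smul_add _) (by simp)
    (by simp [e, coordCLM_apply, hu]) (by simp [e, coordCLM_apply, hv]) 1
  have h1' := congrArg e.symm h1
  have h2' := congrArg e.symm h2
  simp only [one_smul, one_mul, map_add, map_sub, map_smul, LinearEquiv.symm_apply_apply]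
    at h1' h2'
  exact ⟨h1', h2'⟩

theorem expEnd_fixed {A : Module.End ℝ V} {u : V} (hu : A u = 0) : expEnd A u = u := by
  simpa using (expEnd_rotation (A := A) (u := u) (v := 0) (c := 0) (by simpa using hu)
    (by simp)).1

end ExpEnd

/-! ### Real and imaginary parts in the complexification -/

section Complexification

variable {V : Type*} [AddCommGroup V] [Module ℝ V]

variable (V) in
/-- The real part of an element of the complexification. -/
noncomputable def reC : ℂ ⊗[ℝ] V →ₗ[ℝ] V :=
  (TensorProduct.lid ℝ V).toLinearMap ∘ₗ Complex.reLm.rTensor V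

variable (V) in
/-- The imaginary part of an element of the complexification. -/
noncomputable def imC : ℂ ⊗[ℝ] V →ₗ[ℝ] V :=
  (TensorProduct.lid ℝ V).toLinearMap ∘ₗ Complex.imLm.rTensor V

@[simp] theorem reC_tmul (c : ℂ) (x : V) : reC V (c ⊗ₜ x) = c.re • x := by simp [reC]

@[simp] theorem imC_tmul (c : ℂ) (x : V) : imC V (c ⊗ₜ x) = c.im • x := by simp [imC]

/-- The element `x + √-1 y` of the complexification. -/
noncomputable def mkC (x y : V) : ℂ ⊗[ℝ] V := (1 : ℂ) ⊗ₜ x + Complex.I ⊗ₜ y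

theorem mkC_reC_imC (z : ℂ ⊗[ℝ] V) : mkC (reC V z) (imC V z) = z := by
  induction z with
  | zero => simp [mkC]
  | add x y hx hy =>
    conv_rhs => rw [← hx, ← hy]
    simp only [mkC, map_add, TensorProduct.tmul_add]
    abel
  | tmul c x =>
    simp only [mkC, reC_tmul, imC_tmul, ← TensorProduct.smul_tmul, ← TensorProduct.add_tmul]
    congr 1
    apply Complex.ext <;> simp

theorem complexification_ext {z w : ℂ ⊗[ℝ] V} (hre : reC V z = reC V w)
    (him : imC V z = imC V w) : z = w := by
  rw [← mkC_reC_imC z, ← mkC_reC_imC w, hre, him]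

theorem complexification_ext_iff {z w : ℂ ⊗[ℝ] V} :
    z = w ↔ reC V z = reC V w ∧ imC V z = imC V w :=
  ⟨fun h => by simp [h], fun h => complexification_ext h.1 h.2⟩

theorem reC_smul (c : ℂ) (z : ℂ ⊗[ℝ] V) :
    reC V (c • z) = c.re • reC V z - c.im • imC V z := by
  induction z with
  | zero => simp
  | add x y hx hy => simp only [smul_add, map_add, hx, hy]; module
  | tmul d x => simp [TensorProduct.smul_tmul']; module

theorem imC_smul (c : ℂ) (z : ℂ ⊗[ℝ] V) :
    imC V (c • z) = c.re • imC V z + c.im • reC V z := by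
  induction z with
  | zero => simp
  | add x y hx hy => simp only [smul_add, map_add, hx, hy]; module
  | tmul d x => simp [TensorProduct.smul_tmul']; module

variable {V' : Type*} [AddCommGroup V'] [Module ℝ V']

@[simp] theorem reC_baseChange (f : V →ₗ[ℝ] V') (z : ℂ ⊗[ℝ] V) :
    reC V' (f.baseChange ℂ z) = f (reC V z) := by
  induction z with
  | zero => simp
  | add x y hx hy => simp only [map_add, hx, hy]
  | tmul d x => simp

@[simp] theorem imC_baseChange (f : V →ₗ[ℝ] V') (z : ℂ ⊗[ℝ] V) :
    imC V' (f.baseChange ℂ z) = f (imC V z) := by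
  induction z with
  | zero => simp
  | add x y hx hy => simp only [map_add, hx, hy]
  | tmul d x => simp

end Complexification

/-! ### Root spaces in real terms -/

section RootSpaces

variable {g : Type*} [LieRing g] [LieAlgebra ℝ g]

theorem ad_one_tmul (H : g) :
    LieAlgebra.ad ℂ (ℂ ⊗[ℝ] g) ((1 : ℂ) ⊗ₜ[ℝ] H) = (LieAlgebra.ad ℝ g H).baseChange ℂ := by
  ext z
  simp

/-- In real terms a root vector is a pair of vectors that every `ad H` rotates infinitesimally with
speed `⟨α, H⟩`, which is the hypothesis of `expEnd_rotation` and of `RotatesLike`. -/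
theorem mem_rootSpace_iff {B : LinearMap.BilinForm ℝ g} {a : Submodule ℝ g} {α : g}
    {z : ℂ ⊗[ℝ] g} : z ∈ rootSpace B a α ↔ ∀ H ∈ a,
      ⁅H, reC g z⁆ = -(B α H • imC g z) ∧ ⁅H, imC g z⁆ = B α H • reC g z := by
  change (∀ H ∈ a, LieAlgebra.ad ℂ (ℂ ⊗[ℝ] g) ((1 : ℂ) ⊗ₜ[ℝ] H) z = _) ↔ _
  refine forall₂_congr fun H _ => ?_
  rw [complexification_ext_iff, ad_one_tmul, reC_smul, imC_smul]
  simp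

/-- The complexification of an automorphism maps root spaces to root spaces. -/
theorem baseChange_mem_rootSpace {B : LinearMap.BilinForm ℝ g} {a : Submodule ℝ g}
    {φ ψ : g →ₗ[ℝ] g} (hlie : ∀ X Y, φ ⁅X, Y⁆ = ⁅φ X, φ Y⁆) (hψ : ∀ H ∈ a, ψ H ∈ a)
    (hφψ : ∀ H ∈ a, φ (ψ H) = H) {α β : g} (hαβ : ∀ H ∈ a, B α (ψ H) = B β H)
    {z : ℂ ⊗[ℝ] g} (hz : z ∈ rootSpace B a α) : φ.baseChange ℂ z ∈ rootSpace B a β := by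
  rw [mem_rootSpace_iff] at hz ⊢
  intro H hH
  obtain ⟨h1, h2⟩ := hz _ (hψ H hH)
  have h1' := congrArg φ h1
  have h2' := congrArg φ h2
  simp only [hlie, hφψ H hH, map_neg, map_smul, hαβ H hH] at h1' h2'
  simp only [reC_baseChange, imC_baseChange]
  exact ⟨h1', h2'⟩

theorem lie_mem_rootSpace {B : LinearMap.BilinForm ℝ g} {a : Submodule ℝ g} {α β : g}
    {z w : ℂ ⊗[ℝ] g} (hz : z ∈ rootSpace B a α) (hw : w ∈ rootSpace B a β) :
    ⁅z, w⁆ ∈ rootSpace B a (α + β) := by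
  intro H hH
  have h1 := hz H hH
  have h2 := hw H hH
  simp only [LieAlgebra.ad_apply] at h1 h2 ⊢
  have h3 : ∀ c : ℂ, ⁅c • z, w⁆ = c • ⁅z, w⁆ := fun c => smul_lie c z w
  have h4 : ∀ c : ℂ, ⁅z, c • w⁆ = c • ⁅z, w⁆ := fun c => lie_smul c z w
  rw [leibniz_lie, h1, h2, h3, h4, ← add_smul, map_add, LinearMap.add_apply]
  push_cast
  congr 1
  ring

end RootSpaces

/-! ### Symmetric pairs and the spectrum of skew operators -/

section SymmetricPair

variable {g : Type*} [LieRing g] [LieAlgebra ℝ g]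

/-- A simple Lie algebra `g` with an invariant inner product `B`, an involutive automorphism `t`
and a maximal abelian subspace `a` of its `(-1)`-eigenspace. -/
structure IsSymmetricPair (B : LinearMap.BilinForm ℝ g) (t : g →ₗ[ℝ] g) (a : Submodule ℝ g) :
    Prop where
  isSimple : LieAlgebra.IsSimple ℝ g
  inner : IsInvariantInnerProduct B
  map_lie : ∀ X Y, t ⁅X, Y⁆ = ⁅t X, t Y⁆
  involutive : ∀ X, t (t X) = X
  ne_id : t ≠ LinearMap.id
  maximal : IsMaximalAbelian (minusPart t) a

theorem mem_minusPart_iff {t : g →ₗ[ℝ] g} {X : g} : X ∈ minusPart t ↔ t X = -X := by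
  simp [minusPart]

namespace SymTriad.IsInnerProduct

variable {V : Type*} [AddCommGroup V] [Module ℝ V] {B : LinearMap.BilinForm ℝ V}

theorem eq_zero (hB : IsInnerProduct B) {x : V} (h : B x x = 0) : x = 0 := by
  by_contra hx
  exact (hB.pos x hx).ne' h

theorem nonneg (hB : IsInnerProduct B) (x : V) : 0 ≤ B x x := by
  by_cases hx : x = 0
  · simp [hx]
  · exact (hB.pos x hx).le

/-- A vector of a subspace is determined by its inner products with the subspace. -/
theorem eq_of_mem (hB : IsInnerProduct B) {a : Submodule ℝ V} {x y : V} (hx : x ∈ a)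
    (hy : y ∈ a) (h : ∀ z ∈ a, B x z = B y z) : x = y := by
  rw [← sub_eq_zero]
  apply hB.eq_zero
  rw [LinearMap.map_sub B, LinearMap.sub_apply, h _ (a.sub_mem hx hy), sub_self]

/-- Linear functionals on a finite-dimensional subspace are represented by vectors. -/
theorem exists_represent [FiniteDimensional ℝ V] (hB : IsInnerProduct B) (a : Submodule ℝ V)
    (f : a →ₗ[ℝ] ℝ) : ∃ α ∈ a, ∀ z : a, f z = B α z := by
  let T : a →ₗ[ℝ] (a →ₗ[ℝ] ℝ) := B.domRestrict₁₂ a a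
  have hinj : Function.Injective T := fun x y hxy => by
    refine Subtype.ext (hB.eq_of_mem x.2 y.2 fun z hz => ?_)
    exact LinearMap.congr_fun hxy ⟨z, hz⟩
  have hsurj : Function.Surjective T :=
    (LinearMap.injective_iff_surjective_of_finrank_eq_finrank
      (Subspace.dual_finrank_eq (K := ℝ) (V := a)).symm).1 hinj
  obtain ⟨α, hα⟩ := hsurj f
  exact ⟨α, α.2, fun z => (LinearMap.congr_fun hα z).symm⟩

end SymTriad.IsInnerProduct

section Skew

variable {V : Type*} [AddCommGroup V] [Module ℝ V] {B : LinearMap.BilinForm ℝ V}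

theorem reC_smul_sub (A : V →ₗ[ℝ] V) (μ : ℂ) (z : ℂ ⊗[ℝ] V) :
    reC V ((A.baseChange ℂ - algebraMap ℂ _ μ) z) =
      A (reC V z) - μ.re • reC V z + μ.im • imC V z ∧
    imC V ((A.baseChange ℂ - algebraMap ℂ _ μ) z) =
      A (imC V z) - μ.re • imC V z - μ.im • reC V z := by
  simp only [LinearMap.sub_apply, Module.algebraMap_end_apply, map_sub, reC_smul, imC_smul,
    reC_baseChange, imC_baseChange]
  constructor <;> module

/-- The eigenvalues of a skew operator are purely imaginary. -/
theorem re_eq_zero_of_skew (hB : IsInnerProduct B) {A : V →ₗ[ℝ] V}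
    (hA : ∀ x y, B (A x) y = -B x (A y)) {μ : ℂ} {z : ℂ ⊗[ℝ] V} (hz0 : z ≠ 0)
    (hz : (A.baseChange ℂ - algebraMap ℂ _ μ) z = 0) : μ.re = 0 := by
  obtain ⟨h1, h2⟩ := reC_smul_sub A μ z
  rw [hz, map_zero] at h1 h2
  set x := reC V z
  set y := imC V z
  have e1 := congrArg (B x) h1
  have e2 := congrArg (B y) h2
  have s1 := hA x x
  have s2 := hA y y
  rw [hB.symm] at s1 s2
  simp only [map_zero, map_add, map_sub, map_smul, smul_eq_mul] at e1 e2
  rw [hB.symm y x] at e2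
  -- By skewness `B x (A x)` and `B y (A y)` vanish, and the terms in `μ.im` cancel in the sum.
  have key : μ.re * (B x x + B y y) = 0 := by linarith
  rcases mul_eq_zero.1 key with h | h
  · exact h
  · exfalso
    have hx := hB.nonneg x
    have hy := hB.nonneg y
    apply hz0
    apply complexification_ext
    · rw [map_zero]; exact hB.eq_zero (by linarith)
    · rw [map_zero]; exact hB.eq_zero (by linarith)

/-- If `w = (A - μ) z` were nonzero it would be an eigenvector, so `μ` would be imaginary and `A -
μ` skew-Hermitian; then the square norm of `w` is minus the pairing of `z` with `(A - μ) w = 0`. -/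
theorem sub_apply_eq_zero_of_skew (hB : IsInnerProduct B) {A : V →ₗ[ℝ] V}
    (hA : ∀ x y, B (A x) y = -B x (A y)) {μ : ℂ} {z : ℂ ⊗[ℝ] V}
    (hz : (A.baseChange ℂ - algebraMap ℂ _ μ) ((A.baseChange ℂ - algebraMap ℂ _ μ) z) = 0) :
    (A.baseChange ℂ - algebraMap ℂ _ μ) z = 0 := by
  by_contra hw
  have hμ := re_eq_zero_of_skew hB hA hw hz
  obtain ⟨h1, h2⟩ := reC_smul_sub A μ z
  obtain ⟨h3, h4⟩ := reC_smul_sub A μ ((A.baseChange ℂ - algebraMap ℂ _ μ) z)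
  rw [hz, map_zero] at h3 h4
  apply hw
  set w := (A.baseChange ℂ - algebraMap ℂ _ μ) z
  set x := reC V z
  set y := imC V z
  set u := reC V w
  set v := imC V w
  have e1 : B u u = B (A x) u + μ.im * B y u := by
    conv_lhs => enter [1]; rw [h1]
    simp [hμ]
  have e2 : B v v = B (A y) v - μ.im * B x v := by
    conv_lhs => enter [1]; rw [h2]
    simp [hμ]
  have e3 := congrArg (B x) h3
  have e4 := congrArg (B y) h4
  simp only [map_zero, map_add, map_sub, map_smul, smul_eq_mul, hμ, zero_mul, sub_zero] at e3 e4
  rw [hA] at e1 e2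
  have hu := hB.nonneg u
  have hv := hB.nonneg v
  apply complexification_ext
  · rw [map_zero]; exact hB.eq_zero (by linarith)
  · rw [map_zero]; exact hB.eq_zero (by linarith)

/-- Skew operators are semisimple: the exponent of a generalized eigenvector drops one step at a
time down to one. -/
theorem maxGenEigenspace_le_of_skew (hB : IsInnerProduct B) {A : V →ₗ[ℝ] V}
    (hA : ∀ x y, B (A x) y = -B x (A y)) {μ : ℂ} {z : ℂ ⊗[ℝ] V}
    (hz : z ∈ Module.End.maxGenEigenspace (A.baseChange ℂ) μ) :
    (A.baseChange ℂ - algebraMap ℂ _ μ) z = 0 := by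
  obtain ⟨k, hk⟩ := Module.End.mem_maxGenEigenspace _ _ _ |>.1 hz
  rw [← Algebra.algebraMap_eq_smul_one] at hk
  induction k with
  | zero =>
    have : z = 0 := by simpa using hk
    rw [this, map_zero]
  | succ k ih =>
    rcases k with _ | k
    · simpa using hk
    · apply ih
      rw [pow_succ', Module.End.mul_apply]
      apply sub_apply_eq_zero_of_skew hB hA
      rw [pow_succ', pow_succ'] at hk
      exact hk

end Skew

end SymmetricPair

/-! ### Root vectors and Weyl reflections -/

section SymmetricPair

variable {g : Type*} [LieRing g] [LieAlgebra ℝ g]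

namespace IsSymmetricPair

variable {B : LinearMap.BilinForm ℝ g} {t : g →ₗ[ℝ] g} {a : Submodule ℝ g}

section Basic

variable (h : IsSymmetricPair B t a)
include h

theorem isInnerProduct : IsInnerProduct B := h.inner.isInnerProduct

theorem map_eq_neg {H : g} (hH : H ∈ a) : t H = -H :=
  mem_minusPart_iff.1 (h.maximal.prop.1 hH)

theorem lie_eq_zero {H H' : g} (hH : H ∈ a) (hH' : H' ∈ a) : ⁅H, H'⁆ = 0 :=
  h.maximal.prop.2 H hH H' hH'

/-- Adjoining `X` to `a` keeps it abelian inside the `(-1)`-eigenspace, so maximality applies. -/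
theorem mem_of_lie_eq_zero {X : g} (hX : t X = -X) (hXa : ∀ H ∈ a, ⁅H, X⁆ = 0) : X ∈ a := by
  have hle : a ⊔ Submodule.span ℝ {X} ≤ a := by
    refine h.maximal.2 ⟨sup_le h.maximal.prop.1 ?_, ?_⟩ le_sup_left
    · rw [Submodule.span_singleton_le_iff_mem]
      exact mem_minusPart_iff.2 hX
    · intro Z hZ Z' hZ'
      obtain ⟨H, hH, W, hW, rfl⟩ := Submodule.mem_sup.1 hZ
      obtain ⟨H', hH', W', hW', rfl⟩ := Submodule.mem_sup.1 hZ'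
      obtain ⟨r, rfl⟩ := Submodule.mem_span_singleton.1 hW
      obtain ⟨r', rfl⟩ := Submodule.mem_span_singleton.1 hW'
      have h1 : ⁅X, H'⁆ = 0 := by rw [← lie_skew, hXa H' hH', neg_zero]
      simp [h.lie_eq_zero hH hH', hXa H hH, h1]
  exact hle (Submodule.mem_sup_right (Submodule.mem_span_singleton_self X))

theorem eq_zero_of_central {X : g} (hX : ∀ Z : g, ⁅X, Z⁆ = 0) : X = 0 := by
  have := h.isSimple
  have hc : X ∈ LieAlgebra.center ℝ g := by
    rw [LieModule.mem_maxTrivSubmodule]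
    intro Z
    rw [← lie_skew, hX, neg_zero]
  rw [LieAlgebra.center_eq_bot] at hc
  simpa using hc

theorem lie_skew_inner (X Z Z' : g) : B (LieAlgebra.ad ℝ g X Z) Z' =
    -B Z (LieAlgebra.ad ℝ g X Z') := h.inner.invariant X Z Z'

/-- If `a` were zero, every `X - t X` would trivially commute with it and so lie in it, forcing `t =
id`. -/
theorem a_ne_bot : a ≠ ⊥ := by
  intro ha
  apply h.ne_id
  ext X
  have h1 : X - t X ∈ a := h.mem_of_lie_eq_zero (by simp [h.involutive]) (fun H hH => by
    rw [ha, Submodule.mem_bot] at hH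
    simp [hH])
  rw [ha, Submodule.mem_bot, sub_eq_zero] at h1
  exact h1.symm

/-- Every restricted root has root vectors `S`, `T` in the `(±1)`-eigenspaces of the involution,
which span with the root a copy of `𝔰𝔲(2)`. -/
theorem exists_rootVectors {α : g} (hα : α ∈ restrictedRoots B a) : ∃ S T : g, T ≠ 0 ∧
    (∀ H ∈ a, ⁅H, S⁆ = -(B α H • T) ∧ ⁅H, T⁆ = B α H • S) ∧ ⁅S, T⁆ = -(B T T • α) := by
  obtain ⟨hαa, hα0, hne⟩ := hα
  obtain ⟨z, hz, hz0⟩ := Submodule.exists_mem_ne_zero_of_ne_bot hne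
  rw [mem_rootSpace_iff] at hz
  have hαα := h.isInnerProduct.pos α hα0
  have key : ∃ S T : g, t S = S ∧ t T = -T ∧ ¬ (S = 0 ∧ T = 0) ∧
      ∀ H ∈ a, ⁅H, S⁆ = -(B α H • T) ∧ ⁅H, T⁆ = B α H • S := by
    set U := reC g z
    set V := imC g z
    -- Because `t H = -H`, the images under `t` obey the same equations with opposite signs.
    have ht : ∀ H ∈ a, ⁅H, t U⁆ = B α H • t V ∧ ⁅H, t V⁆ = -(B α H • t U) := by
      intro H hH
      obtain ⟨h1, h2⟩ := hz H hH
      have h1' := congrArg t h1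
      have h2' := congrArg t h2
      rw [h.map_lie, h.map_eq_neg hH, neg_lie, map_neg, map_smul, neg_inj] at h1'
      rw [h.map_lie, h.map_eq_neg hH, neg_lie, map_smul, neg_eq_iff_eq_neg] at h2'
      exact ⟨h1', h2'⟩
    -- The pair `U + t U`, `V - t V` symmetrizes `z`. If it vanishes, the same construction for
    -- `-√-1 z` gives the pair `V + t V`, `t U - U`, which cannot vanish as well.
    by_cases h0 : U + t U = 0 ∧ V - t V = 0
    · refine ⟨V + t V, t U - U, by simp [h.involutive, add_comm], by simp [h.involutive], ?_, ?_⟩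
      · rintro ⟨h3, h4⟩
        obtain ⟨h1, h2⟩ := h0
        apply hz0
        have hU : (2 : ℝ) • U = 0 := by
          have : (2 : ℝ) • U = (U + t U) - (t U - U) := by module
          rw [this, h1, h4, sub_zero]
        have hV : (2 : ℝ) • V = 0 := by
          have : (2 : ℝ) • V = (V - t V) + (V + t V) := by module
          rw [this, h2, h3, add_zero]
        apply complexification_ext
        · rw [map_zero]; exact (smul_eq_zero_iff_right two_ne_zero).1 hU
        · rw [map_zero]; exact (smul_eq_zero_iff_right two_ne_zero).1 hV
      · intro H hH
        obtain ⟨h1, h2⟩ := hz H hH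
        obtain ⟨h3, h4⟩ := ht H hH
        constructor
        · rw [lie_add, h2, h4]; module
        · rw [lie_sub, h1, h3]; module
    · refine ⟨U + t U, V - t V, by simp [h.involutive, add_comm], by simp [h.involutive], h0, ?_⟩
      intro H hH
      obtain ⟨h1, h2⟩ := hz H hH
      obtain ⟨h3, h4⟩ := ht H hH
      constructor
      · rw [lie_add, h1, h3]; module
      · rw [lie_sub, h2, h4]; module
  obtain ⟨S, T, hS, hT, h0, hH⟩ := key
  refine ⟨S, T, ?_, hH, ?_⟩
  · rintro rfl
    have := (hH α hαa).2
    rw [lie_zero, eq_comm, smul_eq_zero_iff_right hαα.ne'] at this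
    exact h0 ⟨this, rfl⟩
  -- The bracket is negated by `t` and commutes with `a`; invariance of `B` then determines it by
  -- its inner products with `a`.
  · have hmem : ⁅S, T⁆ ∈ a := by
      apply h.mem_of_lie_eq_zero
      · rw [h.map_lie, hS, hT, lie_neg]
      · intro H hHa
        rw [leibniz_lie, (hH H hHa).1, (hH H hHa).2]
        simp
    refine h.isInnerProduct.eq_of_mem hmem (a.neg_mem (a.smul_mem _ hαa)) fun H hHa => ?_
    have h1 := h.inner.invariant H S T
    have h2 := h.inner.invariant S H T
    rw [h.isInnerProduct.symm, ← neg_eq_iff_eq_neg.2 h2, ← lie_skew, (hH H hHa).1]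
    simp
    ring

end Basic

section Weyl

variable [FiniteDimensional ℝ g]

theorem expEnd_ad_lie (X Z Z' : g) : expEnd (LieAlgebra.ad ℝ g X) ⁅Z, Z'⁆ =
    ⁅expEnd (LieAlgebra.ad ℝ g X) Z, expEnd (LieAlgebra.ad ℝ g X) Z'⁆ :=
  expEnd_leibniz (A := LieAlgebra.ad ℝ g X) (LieAlgebra.ad ℝ g : g →ₗ[ℝ] Module.End ℝ g)
    (fun x y => by simp) Z Z'

/-- The conjugate of `exp (ad X)` by an automorphism `φ` is `exp (ad (φ X))`. -/
theorem expEnd_ad_conj {φ : Module.End ℝ g} (hφ : ∀ Z Z', φ ⁅Z, Z'⁆ = ⁅φ Z, φ Z'⁆) (X : g) :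
    φ * expEnd (LieAlgebra.ad ℝ g X) = expEnd (LieAlgebra.ad ℝ g (φ X)) * φ :=
  expEnd_semiconj (by ext Z; simp [hφ])

theorem expEnd_ad_neg_mul (X : g) :
    expEnd (LieAlgebra.ad ℝ g (-X)) * expEnd (LieAlgebra.ad ℝ g X) = 1 := by
  rw [map_neg]
  exact expEnd_neg_mul _

variable (h : IsSymmetricPair B t a)
include h

/-- The reflection in a restricted root is induced by an automorphism `exp (ad X)`, and its square
is related to the exponential of a multiple of the root. -/
theorem exists_weyl {α : g} (hα : α ∈ restrictedRoots B a) : ∃ X : g,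
    (∀ H ∈ a, expEnd (LieAlgebra.ad ℝ g X) H = reflection B α H) ∧
    expEnd (LieAlgebra.ad ℝ g ((Real.pi / B α α) • α)) X = -X := by
  obtain ⟨S, T, hT0, hH, hST⟩ := h.exists_rootVectors hα
  have hαα := h.isInnerProduct.pos α hα.2.1
  have hTT := h.isInnerProduct.pos T hT0
  -- On the plane of `α` and `T` the operator `ad S` is a rotation of speed `√(B α α * B T T)` up to
  -- sign, so this `s` makes the angle `π` and sends `α` to `-α`.
  set s := Real.pi / Real.sqrt (B α α * B T T) with hs
  have hs2 : s * s * (B α α * B T T) = Real.pi * Real.pi := by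
    have hpos : 0 < B α α * B T T := mul_pos hαα hTT
    have h0 := (Real.sqrt_pos.2 hpos).ne'
    have h1 : s * s * (Real.sqrt (B α α * B T T) * Real.sqrt (B α α * B T T)) =
        Real.pi * Real.pi := by
      rw [hs]
      field_simp
    rwa [Real.mul_self_sqrt hpos.le] at h1
  have hpi := Real.pi_pos
  refine ⟨s • S, ?_, ?_⟩
  · have hrot := (expEnd_rotation (A := LieAlgebra.ad ℝ g (s • S)) (u := α)
      (v := (s * B α α / Real.pi) • T) (c := -Real.pi) (by
        rw [LieAlgebra.ad_apply, smul_lie, ← lie_skew, (hH α hα.1).1, neg_neg, smul_smul,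
          smul_smul, ← neg_smul]
        congr 1
        field_simp) (by
        rw [LieAlgebra.ad_apply, smul_lie, lie_smul, hST, smul_smul, ← neg_smul, smul_smul]
        congr 1
        rw [← mul_right_inj' hpi.ne']
        field_simp
        linarith)).1
    have hα' : expEnd (LieAlgebra.ad ℝ g (s • S)) α = -α := by
      rw [hrot]; simp
    intro H hHa
    -- The component orthogonal to `α` commutes with `S`.
    have hfix : expEnd (LieAlgebra.ad ℝ g (s • S)) (H - (B α H / B α α) • α) =
        H - (B α H / B α α) • α := by
      apply expEnd_fixed
      have hmem : H - (B α H / B α α) • α ∈ a := a.sub_mem hHa (a.smul_mem _ hα.1)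
      rw [LieAlgebra.ad_apply, smul_lie, ← lie_skew, (hH _ hmem).1]
      have : B α (H - (B α H / B α α) • α) = 0 := by
        rw [map_sub, map_smul, smul_eq_mul]
        field_simp
        ring
      rw [this]
      simp
    have hdec : H = (H - (B α H / B α α) • α) + (B α H / B α α) • α := by abel
    conv_lhs => rw [hdec, map_add, hfix, map_smul, hα']
    rw [reflection]
    module
  -- The multiple of `α` has inner product `π` with `α`, so its exponential is the half turn in the
  -- plane of `S` and `T`.
  · have hrot := (expEnd_rotation (A := LieAlgebra.ad ℝ g ((Real.pi / B α α) • α)) (u := S)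
      (v := T) (c := Real.pi) (by
        rw [LieAlgebra.ad_apply, smul_lie, (hH α hα.1).1, smul_neg, smul_smul]
        congr 2
        field_simp) (by
        rw [LieAlgebra.ad_apply, smul_lie, (hH α hα.1).2, smul_smul]
        congr 1
        field_simp)).1
    rw [map_smul, hrot]
    simp

end Weyl

end IsSymmetricPair

end SymmetricPair

/-! ### Reflection invariance and integrality -/

section SymmetricPair

variable {g : Type*} [LieRing g] [LieAlgebra ℝ g]

theorem baseChange_injective {φ ψ : Module.End ℝ g} (hψφ : ψ * φ = 1) :
    Function.Injective (φ.baseChange ℂ) := by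
  intro z w hzw
  have hinv : ∀ x, ψ (φ x) = x := fun x => LinearMap.congr_fun hψφ x
  apply complexification_ext
  · rw [← hinv (reC g z), ← reC_baseChange, hzw, reC_baseChange, hinv]
  · rw [← hinv (imC g z), ← imC_baseChange, hzw, imC_baseChange, hinv]

section Reflection

variable {V : Type*} [AddCommGroup V] [Module ℝ V] {B : LinearMap.BilinForm ℝ V}

theorem reflection_mem_submodule {a : Submodule ℝ V} {α H : V} (hα : α ∈ a) (hH : H ∈ a) :
    reflection B α H ∈ a :=
  a.sub_mem hH (a.smul_mem _ hα)

theorem reflection_reflection {α : V} (hα : B α α ≠ 0) (H : V) :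
    reflection B α (reflection B α H) = H := by
  have h1 : B α (reflection B α H) = -B α H := by
    rw [reflection, map_sub, map_smul, smul_eq_mul]
    field_simp
    ring
  rw [reflection, h1, reflection]
  module

theorem apply_reflection_left (hB : IsInnerProduct B) (α β H : V) :
    B (reflection B α β) H = B β (reflection B α H) := by
  simp only [reflection, map_sub, map_smul, LinearMap.sub_apply, LinearMap.smul_apply, smul_eq_mul]
  rw [hB.symm β α]
  ring

end Reflection

/-- Each of `i`, `j` inverts the other by conjugation, as with quaternion units; hence `i² = j²` and
then `i⁴ = 1`. -/
theorem pow_four_eq_one {M : Type*} [Monoid M] {i j i' j' : M} (hi : i * i' = 1) (hj : j * j' = 1)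
    (hj' : j' * j = 1) (hij : i * j = j' * i) (hji : j * i = i' * j) : i * i * i * i = 1 := by
  have h1 : j * i * j = i := by rw [mul_assoc, hij, ← mul_assoc, hj, one_mul]
  have h2 : i * j * i = j := by rw [mul_assoc, hji, ← mul_assoc, hi, one_mul]
  have h3 : i * i = j * j := by
    calc i * i = i * (j * i * j) := by rw [h1]
      _ = i * j * i * j := by simp only [mul_assoc]
      _ = j * j := by rw [h2]
  have h4 : j * (i * i * i * i) = j := by
    calc j * (i * i * i * i) = j * (i * i) * (i * i) := by simp only [mul_assoc]
      _ = i * i * j * (i * i) := by rw [h3]; simp only [mul_assoc]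
      _ = i * (i * j * i) * i := by simp only [mul_assoc]
      _ = j := by rw [h2, h2]
  rw [← one_mul (i * i * i * i), ← hj', mul_assoc, h4]

namespace IsSymmetricPair

variable {B : LinearMap.BilinForm ℝ g} {t : g →ₗ[ℝ] g} {a : Submodule ℝ g}

variable [FiniteDimensional ℝ g]

variable (h : IsSymmetricPair B t a)
include h

/-- An automorphism acting on `a` as the self-adjoint involution `reflection B α` carries weight `β`
to the reflected weight. -/
theorem exists_reflection_map {α : g} (hα : α ∈ restrictedRoots B a) : ∃ φ : Module.End ℝ g,
    Function.Injective (φ.baseChange ℂ) ∧ ∀ β, ∀ z ∈ rootSpace B a β,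
      φ.baseChange ℂ z ∈ rootSpace B a (reflection B α β) := by
  obtain ⟨X, hX, -⟩ := h.exists_weyl hα
  have hαα := (h.isInnerProduct.pos α hα.2.1).ne'
  refine ⟨expEnd (LieAlgebra.ad ℝ g X), baseChange_injective (expEnd_ad_neg_mul X),
    fun β z hz => ?_⟩
  refine baseChange_mem_rootSpace (ψ := expEnd (LieAlgebra.ad ℝ g X))
    (expEnd_ad_lie X) ?_ ?_ ?_ hz
  · intro H hH
    rw [hX H hH]
    exact reflection_mem_submodule hα.1 hH
  · intro H hH
    rw [hX H hH, hX _ (reflection_mem_submodule hα.1 hH), reflection_reflection hαα]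
  · intro H hH
    rw [hX H hH, apply_reflection_left h.isInnerProduct]

theorem reflection_mem {α β : g} (hα : α ∈ restrictedRoots B a) (hβ : β ∈ restrictedRoots B a) :
    reflection B α β ∈ restrictedRoots B a := by
  have hαα := (h.isInnerProduct.pos α hα.2.1).ne'
  obtain ⟨φ, hφ, hmem⟩ := h.exists_reflection_map hα
  obtain ⟨z, hz, hz0⟩ := Submodule.exists_mem_ne_zero_of_ne_bot hβ.2.2
  refine ⟨reflection_mem_submodule hα.1 hβ.1, fun h0 => hβ.2.1 ?_, ?_⟩
  · rw [← reflection_reflection hαα β, h0]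
    simp [reflection]
  · exact (Submodule.ne_bot_iff _).2 ⟨_, hmem β z hz, (map_ne_zero_iff _ hφ).2 hz0⟩

theorem finrank_le_reflection {α : g} (hα : α ∈ restrictedRoots B a) (β : g) :
    Module.finrank ℂ (rootSpace B a β) ≤ Module.finrank ℂ (rootSpace B a (reflection B α β)) := by
  obtain ⟨φ, hφ, hmem⟩ := h.exists_reflection_map hα
  exact LinearMap.finrank_le_finrank_of_injective
    (f := (φ.baseChange ℂ).restrict (hmem β)) fun z w hzw =>
      Subtype.ext (hφ (congrArg Subtype.val hzw))

theorem isRootMultiplicity :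
    IsRootMultiplicity B (restrictedRoots B a) (restrictedMult B a) where
  pos α hα := by
    rw [restrictedMult, Nat.cast_pos, Nat.pos_iff_ne_zero, Ne, Submodule.finrank_eq_zero]
    exact hα.2.2
  reflection_eq α hα β _ := by
    have hαα := (h.isInnerProduct.pos α hα.2.1).ne'
    rw [restrictedMult, restrictedMult, Nat.cast_inj]
    -- The reflection is an involution, so the inequality at the reflected root gives the converse.
    refine le_antisymm ?_ (h.finrank_le_reflection hα β)
    have := h.finrank_le_reflection hα (reflection B α β)
    rwa [reflection_reflection hαα] at this

/-- With `Z = π α / ‖α‖²`, `exp (ad X)` negates `Z` and `exp (ad Z)` negates `X`, so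
`pow_four_eq_one` makes the fourth power of `exp (ad Z)` trivial. On the root space of `β` it is the
scalar `exp (√-1 π⟨α, β⟩/‖α‖²)`, whose fourth power being one is the claim. -/
theorem integral {α β : g} (hα : α ∈ restrictedRoots B a) (hβ : β ∈ restrictedRoots B a) :
    ∃ k : ℤ, 2 * B α β / B α α = k := by
  obtain ⟨X, hX, hXα⟩ := h.exists_weyl hα
  have hαα := (h.isInnerProduct.pos α hα.2.1).ne'
  set Z := (Real.pi / B α α) • α with hZ
  have hZa : Z ∈ a := a.smul_mem _ hα.1
  have hXZ : expEnd (LieAlgebra.ad ℝ g X) Z = -Z := by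
    rw [hX Z hZa, reflection, hZ, map_smul, smul_eq_mul, ← sub_smul, ← neg_smul]
    congr 1
    field_simp
    ring
  have hinv : ∀ W : g, expEnd (LieAlgebra.ad ℝ g W) * expEnd (LieAlgebra.ad ℝ g (-W)) = 1 :=
    fun W => by simpa using expEnd_ad_neg_mul (-W)
  have h4 := pow_four_eq_one (hinv Z) (hinv X) (expEnd_ad_neg_mul X)
    (by rw [expEnd_ad_conj (expEnd_ad_lie Z) X, hXα])
    (by rw [expEnd_ad_conj (expEnd_ad_lie X) Z, hXZ])
  obtain ⟨z, hz, hz0⟩ := Submodule.exists_mem_ne_zero_of_ne_bot hβ.2.2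
  set c := B β Z
  have hrot : ∀ z ∈ rootSpace B a β, (expEnd (LieAlgebra.ad ℝ g Z)).baseChange ℂ z =
      Complex.exp (c * Complex.I) • z := by
    intro z hz
    obtain ⟨h1, h2⟩ := mem_rootSpace_iff.1 hz Z hZa
    obtain ⟨h3, h4⟩ := expEnd_rotation (A := LieAlgebra.ad ℝ g Z) h1 h2
    apply complexification_ext
    · rw [reC_baseChange, h3, reC_smul, Complex.exp_ofReal_mul_I_re, Complex.exp_ofReal_mul_I_im]
    · rw [imC_baseChange, h4, imC_smul, Complex.exp_ofReal_mul_I_re, Complex.exp_ofReal_mul_I_im,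
        add_comm]
  have hz4 : (Complex.exp (c * Complex.I)) ^ 4 • z = z := by
    set D := expEnd (LieAlgebra.ad ℝ g Z)
    have h5 : ∀ x, D (D (D (D x))) = x := fun x => LinearMap.congr_fun h4 x
    have h6 : D.baseChange ℂ (D.baseChange ℂ (D.baseChange ℂ (D.baseChange ℂ z))) = z := by
      apply complexification_ext
      · simp only [reC_baseChange, h5]
      · simp only [imC_baseChange, h5]
    conv_rhs => rw [← h6]
    simp only [hrot z hz, map_smul, smul_smul]
    congr 1
    ring
  have h5 : Complex.exp (c * Complex.I) ^ 4 = 1 := by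
    rw [← sub_eq_zero]
    refine (smul_eq_zero.1 ?_).resolve_right hz0
    rw [sub_smul, hz4, one_smul, sub_self]
  rw [← Complex.exp_nat_mul, Complex.exp_eq_one_iff] at h5
  obtain ⟨k, hk⟩ := h5
  refine ⟨k, ?_⟩
  have h6 := congrArg Complex.im hk
  simp at h6
  have h7 : c = Real.pi * (B α β / B α α) := by
    simp only [c, hZ, map_smul, smul_eq_mul]
    rw [h.isInnerProduct.symm β α]
    ring
  rw [h7] at h6
  have hpi := Real.pi_pos
  have h8 : Real.pi * (2 * (B α β / B α α)) = Real.pi * k := by linarith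
  have h9 := mul_left_cancel₀ hpi.ne' h8
  rw [← h9]
  ring

end IsSymmetricPair

end SymmetricPair

/-! ### Root space decomposition and irreducibility -/

section SymmetricPair

variable {g : Type*} [LieRing g] [LieAlgebra ℝ g]

/-- The operator `ad H` on the complexification. -/
noncomputable def adC (H : g) : Module.End ℂ (ℂ ⊗[ℝ] g) := (LieAlgebra.ad ℝ g H).baseChange ℂ

@[simp] theorem reC_adC (H : g) (z : ℂ ⊗[ℝ] g) : reC g (adC H z) = ⁅H, reC g z⁆ := by simp [adC]

@[simp] theorem imC_adC (H : g) (z : ℂ ⊗[ℝ] g) : imC g (adC H z) = ⁅H, imC g z⁆ := by simp [adC]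

theorem adC_add (H H' : g) : adC (H + H') = adC H + adC H' := by
  simp [adC, LinearMap.baseChange_add]

theorem adC_apply_of_mem {B : LinearMap.BilinForm ℝ g} {a : Submodule ℝ g} {α H : g}
    {z : ℂ ⊗[ℝ] g} (hz : z ∈ rootSpace B a α) (hH : H ∈ a) :
    adC H z = (Complex.I * (B α H : ℂ)) • z := by
  rw [adC, ← ad_one_tmul]
  exact hz H hH

namespace IsSymmetricPair

variable {B : LinearMap.BilinForm ℝ g} {t : g →ₗ[ℝ] g} {a : Submodule ℝ g}

variable [FiniteDimensional ℝ g]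

variable (h : IsSymmetricPair B t a)
include h

omit [FiniteDimensional ℝ g] in
theorem commute_ad (H H' : a) : Commute (adC (H : g))
    (adC (H' : g)) := by
  have hc : ∀ X : g, ⁅(H : g), ⁅(H' : g), X⁆⁆ = ⁅(H' : g), ⁅(H : g), X⁆⁆ := fun X => by
    rw [leibniz_lie, h.lie_eq_zero H.2 H'.2, zero_lie, zero_add]
  refine LinearMap.ext fun z => complexification_ext ?_ ?_ <;>
    simp [Module.End.mul_apply, hc]

omit [FiniteDimensional ℝ g] in
theorem mapsTo_maxGenEigenspace (H H' : a) (μ : ℂ) :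
    Set.MapsTo (adC (H : g))
      ((adC (H' : g)).maxGenEigenspace μ)
      ((adC (H' : g)).maxGenEigenspace μ) :=
  Module.End.mapsTo_maxGenEigenspace_of_comm (h.commute_ad H' H) μ

omit [FiniteDimensional ℝ g] h in
theorem rootSpace_le (α : g) : rootSpace B a α ≤
    ⨅ H : a, (adC (H : g)).maxGenEigenspace
      (Complex.I * (B α H : ℂ)) := by
  refine le_iInf fun H z hz => ?_
  apply Module.End.eigenspace_le_maxGenEigenspace
  exact Module.End.mem_eigenspace_iff.2 (adC_apply_of_mem hz H.2)

/-- Distinct vectors of `a` give distinct characters, and simultaneous generalized eigenspaces are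
independent; in finite dimension only finitely many are nonzero. -/
theorem finite_restrictedRoots : (restrictedRoots B a).Finite := by
  have hind := Module.End.independent_iInf_maxGenEigenspace_of_forall_mapsTo
    (fun H : a => adC (H : g)) h.mapsTo_maxGenEigenspace
  let χ : a → a → ℂ := fun α H => Complex.I * (B α H : ℂ)
  have hχ : Function.Injective χ := fun α β hαβ => by
    refine Subtype.ext (h.isInnerProduct.eq_of_mem α.2 β.2 fun H hH => ?_)
    have := mul_left_cancel₀ Complex.I_ne_zero (congrFun hαβ ⟨H, hH⟩)
    exact_mod_cast this
  have hind' := (hind.comp hχ).mono (fun α => rootSpace_le (B := B) (a := a) (α : g))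
  have hfin := WellFoundedGT.finite_ne_bot_of_iSupIndep hind'
  refine (hfin.image Subtype.val).subset fun α hα => ⟨⟨α, hα.1⟩, hα.2.2, rfl⟩

/-- Commuting operators over `ℂ` split the space into simultaneous generalized eigenspaces. Skewness
turns these into genuine eigenspaces with imaginary characters, and the imaginary part of a
character is represented by a vector of `a`. -/
theorem iSup_rootSpace : ⨆ α : a, rootSpace B a (α : g) = ⊤ := by
  rw [eq_top_iff, ← Module.End.iSup_iInf_maxGenEigenspace_eq_top_of_forall_mapsTo
    (fun H : a => adC (H : g)) h.mapsTo_maxGenEigenspace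
    (fun H => Module.End.iSup_maxGenEigenspace_eq_top _)]
  refine iSup_le fun χ => ?_
  by_cases hbot : (⨅ H : a, (adC (H : g)).maxGenEigenspace (χ H)) = ⊥
  · rw [hbot]; exact bot_le
  have heig : ∀ z ∈ (⨅ H : a, (adC (H : g)).maxGenEigenspace (χ H)),
      ∀ H : a, (adC (H : g) - algebraMap ℂ _ (χ H)) z = 0 :=
    fun z hz H => maxGenEigenspace_le_of_skew h.isInnerProduct (h.lie_skew_inner H)
      ((Submodule.mem_iInf _).1 hz H)
  obtain ⟨z, hz, hz0⟩ := Submodule.exists_mem_ne_zero_of_ne_bot hbot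
  have hre : ∀ H, (χ H).re = 0 := fun H =>
    re_eq_zero_of_skew h.isInnerProduct (h.lie_skew_inner H) hz0 (heig z hz H)
  have heq : ∀ z ∈ (⨅ H : a, (adC (H : g)).maxGenEigenspace (χ H)),
      ∀ H : a, adC (H : g) z = χ H • z := fun z hz H => by
    have := heig z hz H
    rwa [LinearMap.sub_apply, Module.algebraMap_end_apply, sub_eq_zero] at this
  -- Linearity holds because `χ H` is the eigenvalue of `ad H` on the fixed nonzero `z`.
  let f : a →ₗ[ℝ] ℝ :=
    { toFun := fun H => (χ H).im
      map_add' := fun H H' => by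
        have h1 : χ (H + H') = χ H + χ H' := by
          refine smul_left_injective ℂ hz0 ?_
          simp only [add_smul, ← heq z hz]
          simp [adC_add]
        rw [h1, Complex.add_im]
      map_smul' := fun r H => by
        have h1 : χ (r • H) = (r : ℂ) * χ H := by
          refine smul_left_injective ℂ hz0 ?_
          simp only [mul_smul, ← heq z hz]
          refine complexification_ext ?_ ?_ <;>
            simp only [reC_smul, imC_smul, reC_adC, imC_adC, Complex.ofReal_re,
              Complex.ofReal_im, zero_smul, sub_zero, add_zero, Submodule.coe_smul, smul_lie]
        simp [h1] }
  obtain ⟨α, hα, hfα⟩ := h.isInnerProduct.exists_represent a f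
  refine le_trans (fun w hw => ?_) (le_iSup (fun α : a => rootSpace B a (α : g)) ⟨α, hα⟩)
  intro H hH
  rw [ad_one_tmul, ← adC, heq w hw ⟨H, hH⟩]
  congr 1
  have h1 : (χ ⟨H, hH⟩).im = B α H := hfα ⟨H, hH⟩
  apply Complex.ext
  · simp [hre]
  · simp [h1]

/-- An element of `a` orthogonal to all restricted roots vanishes. -/
theorem eq_zero_of_orthogonal {H : g} (hH : H ∈ a) (horth : ∀ α ∈ restrictedRoots B a, B α H = 0) :
    H = 0 := by
  -- On each root space `H` acts by `√-1⟨α, H⟩ = 0`, and these spaces span; so `H` is central.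
  have hker : ∀ z, adC H z = 0 := by
    intro z
    have hz : z ∈ ⨆ α : a, rootSpace B a (α : g) := by rw [h.iSup_rootSpace]; trivial
    have hle : (⨆ α : a, rootSpace B a (α : g)) ≤
        LinearMap.ker (adC H) := by
      refine iSup_le fun α w hw => ?_
      rw [LinearMap.mem_ker, adC_apply_of_mem hw hH]
      by_cases h0 : (α : g) = 0
      · simp [h0]
      by_cases hb : rootSpace B a (α : g) = ⊥
      · rw [hb, Submodule.mem_bot] at hw
        simp [hw]
      · simp [horth α ⟨α.2, h0, hb⟩]
    exact hle hz
  apply h.eq_zero_of_central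
  intro Z
  have := congrArg (reC g) (hker ((1 : ℂ) ⊗ₜ Z))
  simpa using this

/-- The difference of `X ∈ a` and its orthogonal projection to the span is orthogonal to all roots.
-/
theorem span_restrictedRoots : Submodule.span ℝ (restrictedRoots B a) = a := by
  refine le_antisymm (Submodule.span_le.2 fun α hα => hα.1) fun X hX => ?_
  obtain ⟨Z, hZ, hXZ⟩ := h.isInnerProduct.exists_represent
    (Submodule.span ℝ (restrictedRoots B a)) ((B X).domRestrict _)
  have hZa : Z ∈ a := Submodule.span_le.2 (fun α (hα : α ∈ restrictedRoots B a) => hα.1) hZ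
  have : X - Z = 0 := by
    refine h.eq_zero_of_orthogonal (a.sub_mem hX hZa) fun α hα => ?_
    have h1 := hXZ ⟨α, Submodule.subset_span hα⟩
    rw [LinearMap.domRestrict_apply] at h1
    rw [h.isInnerProduct.symm, map_sub, LinearMap.sub_apply, h1, sub_self]
  rwa [sub_eq_zero.1 this]

theorem isRootSystem : IsRootSystem B a (restrictedRoots B a) where
  finite := h.finite_restrictedRoots
  zero_notMem h0 := h0.2.1 rfl
  span_eq := h.span_restrictedRoots
  reflection_mem _ hα _ hβ := h.reflection_mem hα hβ
  integral _ hα _ hβ := h.integral hα hβ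

theorem restrictedRoots_nonempty : (restrictedRoots B a).Nonempty := by
  by_contra hne
  rw [Set.not_nonempty_iff_eq_empty] at hne
  apply h.a_ne_bot
  rw [← h.span_restrictedRoots, hne, Submodule.span_empty]

/-- For orthogonal parts, a sum `α + β` would be orthogonal to neither part and so is no root; thus
root spaces of the two parts commute. The centralizer `J` of the root spaces of `Δ₂` is then an
ideal that contains `α₁` but not `α₂`, against simplicity. -/
theorem not_isReducible : ¬ IsReducible B (restrictedRoots B a) := by
  rintro ⟨Δ₁, Δ₂, ⟨α₁, hα₁⟩, ⟨α₂, hα₂⟩, hΔ, -, horth⟩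
  have hsub₁ : Δ₁ ⊆ restrictedRoots B a := hΔ ▸ Set.subset_union_left
  have hsub₂ : Δ₂ ⊆ restrictedRoots B a := hΔ ▸ Set.subset_union_right
  have hpos : ∀ α ∈ restrictedRoots B a, 0 < B α α := fun α hα => h.isInnerProduct.pos α hα.2.1
  have hcomm : ∀ α ∈ Δ₁, ∀ β ∈ Δ₂, ∀ z ∈ rootSpace B a α, ∀ w ∈ rootSpace B a β,
      ⁅z, w⁆ = 0 := by
    intro α hα β hβ z hz w hw
    have hmem := lie_mem_rootSpace hz hw
    have hαα := hpos α (hsub₁ hα)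
    have hββ := hpos β (hsub₂ hβ)
    have hαβ := horth α hα β hβ
    by_contra hne
    have hroot : α + β ∈ restrictedRoots B a := by
      refine ⟨a.add_mem (hsub₁ hα).1 (hsub₂ hβ).1, fun h0 => ?_, ?_⟩
      · have := congrArg (B α) h0
        rw [map_add, map_zero, hαβ] at this
        linarith
      · exact (Submodule.ne_bot_iff _).2 ⟨_, hmem, hne⟩
    rw [hΔ] at hroot
    rcases hroot with h1 | h2
    · have := horth _ h1 β hβ
      rw [map_add, LinearMap.add_apply, hαβ] at this
      linarith
    · have := horth α hα _ h2
      rw [map_add, hαβ] at this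
      linarith
  -- Stability of the centralizer is tested on `η` in one root space: weight zero preserves the
  -- space of `w`, a root of `Δ₁` commutes with `w`, and for a root of `Δ₂` the element `ζ` kills
  -- both `η` and `w`.
  have hstable : ∀ ζ : ℂ ⊗[ℝ] g, (∀ β ∈ Δ₂, ∀ w ∈ rootSpace B a β, ⁅ζ, w⁆ = 0) →
      ∀ η : ℂ ⊗[ℝ] g, ∀ β ∈ Δ₂, ∀ w ∈ rootSpace B a β, ⁅⁅η, ζ⁆, w⁆ = 0 := by
    intro ζ hζ η β hβ w hw
    have hη : η ∈ ⨆ α : a, rootSpace B a (α : g) := by rw [h.iSup_rootSpace]; trivial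
    refine Submodule.iSup_induction _ (motive := fun η => ⁅⁅η, ζ⁆, w⁆ = 0) hη ?_ (by simp)
      (fun x y hx hy => by rw [add_lie, add_lie, hx, hy, add_zero])
    intro γ η hη
    rw [lie_lie, hζ β hβ w hw, lie_zero, zero_sub, neg_eq_zero]
    by_cases h0 : (γ : g) = 0
    · have := lie_mem_rootSpace hη hw
      rw [h0, zero_add] at this
      exact hζ β hβ _ this
    by_cases hb : rootSpace B a (γ : g) = ⊥
    · rw [hb, Submodule.mem_bot] at hη
      simp [hη]
    have hγ : (γ : g) ∈ restrictedRoots B a := ⟨γ.2, h0, hb⟩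
    rw [hΔ] at hγ
    rcases hγ with h1 | h2
    · rw [hcomm γ h1 β hβ η hη w hw, lie_zero]
    · rw [leibniz_lie, hζ γ h2 η hη, hζ β hβ w hw, lie_zero, zero_lie, zero_add]
  let J : LieIdeal ℝ g :=
    { carrier := {X | ∀ β ∈ Δ₂, ∀ w ∈ rootSpace B a β, ⁅(1 : ℂ) ⊗ₜ[ℝ] X, w⁆ = 0}
      add_mem' := fun {X Y} hX hY β hβ w hw => by
        rw [TensorProduct.tmul_add, add_lie, hX β hβ w hw, hY β hβ w hw, add_zero]
      zero_mem' := fun β hβ w hw => by simp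
      smul_mem' := fun r X hX β hβ w hw => by
        have h1 : (1 : ℂ) ⊗ₜ[ℝ] (r • X) = (r : ℂ) • ((1 : ℂ) ⊗ₜ[ℝ] X) := by
          apply complexification_ext <;>
            simp only [reC_smul, imC_smul, reC_tmul, imC_tmul, Complex.ofReal_re,
              Complex.ofReal_im, Complex.one_re, Complex.one_im, one_smul, zero_smul, sub_zero,
              smul_zero, add_zero]
        have h2 : ∀ (c : ℂ) (z : ℂ ⊗[ℝ] g), ⁅c • z, w⁆ = c • ⁅z, w⁆ := fun c z => smul_lie c z w
        rw [h1, h2, hX β hβ w hw, smul_zero]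
      lie_mem := fun {Y X} hX β hβ w hw => by
        have h1 : (1 : ℂ) ⊗ₜ[ℝ] ⁅Y, X⁆ = ⁅(1 : ℂ) ⊗ₜ[ℝ] Y, (1 : ℂ) ⊗ₜ[ℝ] X⁆ := by simp
        rw [h1]
        exact hstable _ hX _ β hβ w hw }
  have hact : ∀ H ∈ a, ∀ β, ∀ w ∈ rootSpace B a β,
      ⁅(1 : ℂ) ⊗ₜ[ℝ] H, w⁆ = (Complex.I * (B β H : ℂ)) • w := fun H hH β w hw => hw H hH
  have hα₁J : α₁ ∈ J := fun β hβ w hw => by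
    rw [hact α₁ (hsub₁ hα₁).1 β w hw, h.isInnerProduct.symm, horth α₁ hα₁ β hβ]
    simp
  have hα₂J : α₂ ∉ J := fun hJ => by
    obtain ⟨w, hw, hw0⟩ := Submodule.exists_mem_ne_zero_of_ne_bot (hsub₂ hα₂).2.2
    have h1 := hJ α₂ hα₂ w hw
    rw [hact α₂ (hsub₂ hα₂).1 α₂ w hw] at h1
    have h2 := (smul_eq_zero.1 h1).resolve_right hw0
    simp [(hpos α₂ (hsub₂ hα₂)).ne'] at h2
  rcases h.isSimple.eq_bot_or_eq_top J with hJ | hJ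
  · rw [hJ] at hα₁J
    exact (hsub₁ hα₁).2.1 (by simpa using hα₁J)
  · rw [hJ] at hα₂J
    exact hα₂J trivial

theorem isIrreducibleRootSystem : IsIrreducibleRootSystem B a (restrictedRoots B a) where
  isRootSystem := h.isRootSystem
  nonempty := h.restrictedRoots_nonempty
  not_reducible := h.not_isReducible

end IsSymmetricPair

end SymmetricPair

/-! ### Involutions conjugate by the exponential of `Y` -/

section SymmetricPair

variable {g : Type*} [LieRing g] [LieAlgebra ℝ g]

/-- `R` is a rotation by the angle `s c` in every plane in which `ad Y` is an infinitesimal rotation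
with speed `c`, as is the case for `R = exp (s ad Y)`. -/
def RotatesLike (Y : g) (s : ℝ) (R : g →ₗ[ℝ] g) : Prop :=
  ∀ (u v : g) (c : ℝ), ⁅Y, u⁆ = -(c • v) → ⁅Y, v⁆ = c • u →
    R u = Real.cos (s * c) • u - Real.sin (s * c) • v ∧
      R v = Real.sin (s * c) • u + Real.cos (s * c) • v

theorem RotatesLike.apply_of_lie_eq_zero {Y : g} {s : ℝ} {R : g →ₗ[ℝ] g} (hR : RotatesLike Y s R)
    {H : g} (hH : ⁅Y, H⁆ = 0) : R H = H := by
  simpa using (hR H 0 0 (by simpa using hH) (by simp)).1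

section Parity

variable {V : Type*} [AddCommGroup V] [Module ℝ V] {B : LinearMap.BilinForm ℝ V} {Δ : Set V} {Y : V}

theorem notMem_sigmaAt_of_mem_wAt {l : V} (hl : l ∈ wAt B Δ Y) : l ∉ sigmaAt B Δ Y := by
  rintro ⟨-, k, hk⟩
  obtain ⟨-, k', hk'⟩ := hl
  have hpi := Real.pi_pos
  have h1 : Real.pi * (2 * k) = Real.pi * (1 + 2 * k') := by linarith
  have h2 : (2 * k : ℝ) = 1 + 2 * k' := mul_left_cancel₀ hpi.ne' h1
  have h3 : 2 * k = 1 + 2 * k' := by exact_mod_cast h2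
  omega

end Parity

namespace IsSymmetricPair

variable {B : LinearMap.BilinForm ℝ g} {t₁ t₂ : g →ₗ[ℝ] g} {a : Submodule ℝ g} {Y : g}
  {R R' : g →ₗ[ℝ] g}

section Conjugate

variable (h : IsSymmetricPair B t₁ a) (hY : Y ∈ a) (hR : RotatesLike Y 1 R)
  (hR' : RotatesLike Y (-1) R') (ht₂ : t₂ = R ∘ₗ t₁ ∘ₗ R')
include h hY hR hR' ht₂

/-- Since `Y` commutes with `a`, both `R` and `R'` fix `a` pointwise, so `t₂` agrees with `t₁`
there. -/
theorem le_minusPart_conj : a ≤ minusPart t₂ := by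
  intro H hH
  have h0 := h.lie_eq_zero hY hH
  rw [mem_minusPart_iff, ht₂, LinearMap.comp_apply, LinearMap.comp_apply,
    hR'.apply_of_lie_eq_zero h0, h.map_eq_neg hH, map_neg, hR.apply_of_lie_eq_zero h0]

theorem isMaximalAbelian_inf : IsMaximalAbelian (minusPart t₁ ⊓ minusPart t₂) a :=
  ⟨⟨le_inf h.maximal.prop.1 (h.le_minusPart_conj hY hR hR' ht₂), h.maximal.prop.2⟩,
    fun _ hb hab => h.maximal.2 ⟨hb.1.trans inf_le_left, hb.2⟩ hab⟩

/-- The product `t₁ t₂` acts by a scalar on the root space of `α`. -/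
theorem comp_apply_of_mem_rootSpace {α : g} {z : ℂ ⊗[ℝ] g} (hz : z ∈ rootSpace B a α) :
    (t₁ ∘ₗ t₂).baseChange ℂ z = Complex.exp (((-(2 * B α Y) : ℝ) : ℂ) * Complex.I) • z := by
  obtain ⟨h1, h2⟩ := mem_rootSpace_iff.1 hz Y hY
  set U := reC g z with hU
  set V := imC g z with hV
  set c := B α Y
  obtain ⟨e1, e2⟩ := hR' U V c h1 h2
  -- As `t₁ Y = -Y`, the pair `t₁ U`, `-t₁ V` again rotates with speed `c`. Hence `t₁ R t₁` and `R'`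
  -- turn the plane of `U`, `V` in the same direction, by `2 c` in all.
  have h3 : ⁅Y, t₁ U⁆ = -(c • (-t₁ V)) := by
    have := congrArg t₁ h1
    rw [h.map_lie, h.map_eq_neg hY, neg_lie, map_neg, map_smul, neg_inj] at this
    rw [this, smul_neg, neg_neg]
  have h4 : ⁅Y, -t₁ V⁆ = c • t₁ U := by
    have := congrArg t₁ h2
    rwa [h.map_lie, h.map_eq_neg hY, neg_lie, map_smul, ← lie_neg] at this
  obtain ⟨e3, e4⟩ := hR _ _ c h3 h4
  rw [map_neg, neg_eq_iff_eq_neg] at e4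
  have hc2 : Real.cos (2 * c) = Real.cos c * Real.cos c - Real.sin c * Real.sin c := by
    rw [two_mul, Real.cos_add]
  have hs2 : Real.sin (2 * c) = Real.sin c * Real.cos c + Real.cos c * Real.sin c := by
    rw [two_mul, Real.sin_add]
  simp only [neg_mul, one_mul, Real.cos_neg, Real.sin_neg] at e1 e2 e3 e4
  have f1 : t₁ (t₂ U) = Real.cos (2 * c) • U + Real.sin (2 * c) • V := by
    rw [ht₂, LinearMap.comp_apply, LinearMap.comp_apply, e1]
    simp only [map_sub, map_smul, e3, e4, map_add, map_neg, h.involutive, hc2, hs2]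
    module
  have f2 : t₁ (t₂ V) = -(Real.sin (2 * c) • U) + Real.cos (2 * c) • V := by
    rw [ht₂, LinearMap.comp_apply, LinearMap.comp_apply, e2]
    simp only [map_add, map_smul, e3, e4, map_sub, map_neg, h.involutive, hc2, hs2]
    module
  apply complexification_ext
  · rw [reC_baseChange, reC_smul, Complex.exp_ofReal_mul_I_re, Complex.exp_ofReal_mul_I_im,
      Real.cos_neg, Real.sin_neg, LinearMap.comp_apply, f1]
    module
  · rw [imC_baseChange, imC_smul, Complex.exp_ofReal_mul_I_re, Complex.exp_ofReal_mul_I_im,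
      Real.cos_neg, Real.sin_neg, LinearMap.comp_apply, f2]
    module

theorem rootSpaceEps_eq {α : g} {ε : ℂ}
    (hε : Complex.exp (((-(2 * B α Y) : ℝ) : ℂ) * Complex.I) = ε) :
    rootSpaceEps B a (t₁ ∘ₗ t₂) α ε = rootSpace B a α ∧
      rootSpaceEps B a (t₁ ∘ₗ t₂) α (-ε) = ⊥ := by
  constructor
  · refine inf_eq_left.2 fun z hz => ?_
    rw [Module.End.mem_eigenspace_iff, h.comp_apply_of_mem_rootSpace hY hR hR' ht₂ hz, hε]
  · rw [Submodule.eq_bot_iff]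
    rintro z ⟨hz, hz'⟩
    rw [SetLike.mem_coe, Module.End.mem_eigenspace_iff,
      h.comp_apply_of_mem_rootSpace hY hR hR' ht₂ hz, hε, neg_smul,
      eq_neg_iff_add_eq_zero, ← add_smul, smul_eq_zero, add_self_eq_zero] at hz'
    refine hz'.resolve_left ?_
    rw [← hε]
    exact Complex.exp_ne_zero _

variable (hinv : ∀ X, t₂ (t₂ X) = X) (hcomm : ∀ X, t₁ (t₂ X) = t₂ (t₁ X))
include hinv hcomm

/-- Commuting involutions have a product of square one, so the scalar by which it acts on the root
space squares to one. -/
theorem exists_apply_eq {α : g} (hα : α ∈ restrictedRoots B a) :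
    ∃ k : ℤ, B α Y = Real.pi / 2 * k := by
  obtain ⟨z, hz, hz0⟩ := Submodule.exists_mem_ne_zero_of_ne_bot hα.2.2
  set e := Complex.exp (((-(2 * B α Y) : ℝ) : ℂ) * Complex.I) with he
  have h1 := fun z hz => h.comp_apply_of_mem_rootSpace (α := α) (z := z) hY hR hR' ht₂ hz
  have h2 : (t₁ ∘ₗ t₂).baseChange ℂ ((t₁ ∘ₗ t₂).baseChange ℂ z) = z := by
    have h3 : ∀ X, t₁ (t₂ (t₁ (t₂ X))) = X := fun X => by
      rw [hcomm (t₁ (t₂ X)), h.involutive, hinv]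
    apply complexification_ext
    · simp only [reC_baseChange, LinearMap.comp_apply, h3]
    · simp only [imC_baseChange, LinearMap.comp_apply, h3]
  rw [h1 z hz, map_smul, h1 z hz, smul_smul] at h2
  have h3 : e * e = 1 := by
    rw [← sub_eq_zero]
    refine (smul_eq_zero.1 ?_).resolve_right hz0
    rw [sub_smul, h2, one_smul, sub_self]
  rw [he, ← Complex.exp_add, Complex.exp_eq_one_iff] at h3
  obtain ⟨k, hk⟩ := h3
  have h4 := congrArg Complex.im hk
  simp at h4
  -- The exponent of `e * e` is `-4⟨α, Y⟩√-1`, whence the sign.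
  refine ⟨-k, ?_⟩
  push_cast
  linarith

theorem mem_latticeΓ : Y ∈ latticeΓ B a (restrictedRoots B a) :=
  ⟨hY, fun _ hl => h.exists_apply_eq hY hR hR' ht₂ hinv hcomm hl⟩

/-- Everything is decided by the parity of `k` in `⟨α, Y⟩ = kπ/2`. -/
theorem sigmaAt_or_wAt {α : g} (hα : α ∈ restrictedRoots B a) :
    (α ∈ sigmaAt B (restrictedRoots B a) Y ∧ α ∉ wAt B (restrictedRoots B a) Y ∧
      rootSpaceEps B a (t₁ ∘ₗ t₂) α 1 = rootSpace B a α ∧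
      rootSpaceEps B a (t₁ ∘ₗ t₂) α (-1) = ⊥) ∨
    (α ∈ wAt B (restrictedRoots B a) Y ∧ α ∉ sigmaAt B (restrictedRoots B a) Y ∧
      rootSpaceEps B a (t₁ ∘ₗ t₂) α 1 = ⊥ ∧
      rootSpaceEps B a (t₁ ∘ₗ t₂) α (-1) = rootSpace B a α) := by
  obtain ⟨k, hk⟩ := h.exists_apply_eq hY hR hR' ht₂ hinv hcomm hα
  rcases Int.even_or_odd' k with ⟨m, rfl | rfl⟩
  · left
    have hmem : α ∈ sigmaAt B (restrictedRoots B a) Y := ⟨hα, m, by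
      rw [map_smul, smul_eq_mul, hk]; push_cast; ring⟩
    refine ⟨hmem, fun hw => notMem_sigmaAt_of_mem_wAt hw hmem,
      h.rootSpaceEps_eq hY hR hR' ht₂ ?_⟩
    rw [Complex.exp_eq_one_iff]
    refine ⟨-m, ?_⟩
    rw [hk]
    push_cast
    ring
  · right
    have hmem : α ∈ wAt B (restrictedRoots B a) Y := ⟨hα, m, by
      rw [map_smul, smul_eq_mul, hk]; push_cast; ring⟩
    refine ⟨hmem, notMem_sigmaAt_of_mem_wAt hmem, ?_⟩
    have h1 := h.rootSpaceEps_eq (α := α) (ε := -1) hY hR hR' ht₂ (by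
      have h2 : (((-(2 * B α Y) : ℝ) : ℂ) * Complex.I) =
          Real.pi * Complex.I + (-(m + 1) : ℤ) * (2 * Real.pi * Complex.I) := by
        rw [hk]; push_cast; ring
      rw [h2, Complex.exp_add, Complex.exp_int_mul_two_pi_mul_I, Complex.exp_pi_mul_I, mul_one])
    rw [neg_neg] at h1
    exact h1.symm

/-- The triad of a pair of involutions which are conjugate by `exp Y` is of type (IV). -/
theorem isTypeIVWith [FiniteDimensional ℝ g] : IsTypeIVWith B a (triadOf B a t₁ t₂)
    (restrictedRoots B a) (restrictedMult B a) Y := by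
  have key := fun α hα => h.sigmaAt_or_wAt (α := α) hY hR hR' ht₂ hinv hcomm hα
  have hσ : (triadOf B a t₁ t₂).sigma = sigmaAt B (restrictedRoots B a) Y := by
    ext α
    constructor
    · rintro ⟨h1, h2, h3, h4⟩
      rcases key α ⟨h1, h2, h3⟩ with h5 | h5
      · exact h5.1
      · exact absurd h5.2.2.1 h4
    · intro hα
      obtain ⟨h1, h2, h3⟩ := hα.1
      rcases key α hα.1 with h5 | h5
      · exact ⟨h1, h2, h3, by rwa [h5.2.2.1]⟩
      · exact absurd hα h5.2.1
  have hw : (triadOf B a t₁ t₂).w = wAt B (restrictedRoots B a) Y := by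
    ext α
    constructor
    · rintro ⟨h1, h2, h3, h4⟩
      rcases key α ⟨h1, h2, h3⟩ with h5 | h5
      · exact absurd h5.2.2.2 h4
      · exact h5.1
    · intro hα
      obtain ⟨h1, h2, h3⟩ := hα.1
      rcases key α hα.1 with h5 | h5
      · exact absurd hα h5.2.1
      · exact ⟨h1, h2, h3, by rwa [h5.2.2.2]⟩
  have hσ' : ∀ l ∈ (triadOf B a t₁ t₂).sigma, rootSpaceEps B a (t₁ ∘ₗ t₂) l 1 = rootSpace B a l ∧
      rootSpaceEps B a (t₁ ∘ₗ t₂) l (-1) = ⊥ := by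
    intro l hl
    rw [hσ] at hl
    rcases key l hl.1 with h5 | h5
    · exact h5.2.2
    · exact absurd hl h5.2.1
  have hw' : ∀ l ∈ (triadOf B a t₁ t₂).w, rootSpaceEps B a (t₁ ∘ₗ t₂) l 1 = ⊥ ∧
      rootSpaceEps B a (t₁ ∘ₗ t₂) l (-1) = rootSpace B a l := by
    intro l hl
    rw [hw] at hl
    rcases key l hl.1 with h5 | h5
    · exact absurd hl h5.2.1
    · exact h5.2.2
  exact
    { irreducible := h.isIrreducibleRootSystem
      isMultiplicity := h.isRootMultiplicity
      mem_lattice := h.mem_latticeΓ hY hR hR' ht₂ hinv hcomm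
      tildeSigma_eq := rfl
      sigma_eq := hσ
      w_eq := hw
      w_eq_diff := by
        rw [hw]
        ext α
        constructor
        · exact fun hα => ⟨hα.1, notMem_sigmaAt_of_mem_wAt hα⟩
        · rintro ⟨hα, hα'⟩
          rcases key α hα with h5 | h5
          · exact absurd h5.1 hα'
          · exact h5.1
      m_sigma := fun l hl =>
        congrArg (fun S : Submodule ℂ (ℂ ⊗[ℝ] g) => (Module.finrank ℂ S : ℝ)) (hσ' l hl).1
      n_sigma := fun l hl => by simp [triadOf, (hσ' l hl).2]
      m_w := fun l hl => by simp [triadOf, (hw' l hl).1]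
      n_w := fun l hl =>
        congrArg (fun S : Submodule ℂ (ℂ ⊗[ℝ] g) => (Module.finrank ℂ S : ℝ)) (hw' l hl).2 }

end Conjugate

end IsSymmetricPair

end SymmetricPair

/-! ### Maps with vanishing derivative -/

section LocallyConstant

variable {E : Type*} [NormedAddCommGroup E] [NormedSpace ℝ E]
  {M : Type*} [TopologicalSpace M] [ChartedSpace E M] [IsManifold 𝓘(ℝ, E) 1 M]
  {E' : Type*} [NormedAddCommGroup E'] [NormedSpace ℝ E']
  {N : Type*} [TopologicalSpace N] [ChartedSpace E' N] [IsManifold 𝓘(ℝ, E') 1 N]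

/-- A map between manifolds with vanishing derivative is locally constant. -/
theorem isLocallyConstant_of_hasMFDerivAt_zero {f : M → N}
    (hf : ∀ x, HasMFDerivAt 𝓘(ℝ, E) 𝓘(ℝ, E') f x 0) : IsLocallyConstant f := by
  rw [IsLocallyConstant.iff_eventually_eq]
  intro x
  set φ := extChartAt 𝓘(ℝ, E) x
  set ψ := extChartAt 𝓘(ℝ, E') (f x)
  have hcont : Continuous f := continuous_iff_continuousAt.2 fun x => (hf x).continuousAt
  -- On this neighbourhood `f` stays in the target chart, so its coordinate expression is
  -- differentiable with zero derivative.
  have hnhds : φ.target ∩ φ.symm ⁻¹' (f ⁻¹' ψ.source) ∈ nhds (φ x) := by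
    refine Filter.inter_mem (extChartAt_target_mem_nhds x) ?_
    refine (continuousAt_extChartAt_symm x).preimage_mem_nhds ?_
    rw [extChartAt_to_inv]
    exact hcont.continuousAt.preimage_mem_nhds (extChartAt_source_mem_nhds (f x))
  obtain ⟨r, hr, hball⟩ := Metric.mem_nhds_iff.1 hnhds
  have hd : ∀ z ∈ Metric.ball (φ x) r, HasFDerivAt (ψ ∘ f ∘ φ.symm) (0 : E →L[ℝ] E') z := by
    intro z hz
    obtain ⟨h1, h2⟩ := hball hz
    have hφ : MDifferentiableAt 𝓘(ℝ, E) 𝓘(ℝ, E) φ.symm z := by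
      have := mdifferentiableWithinAt_extChartAt_symm (I := 𝓘(ℝ, E)) h1
      rwa [modelWithCornersSelf_coe, Set.range_id, mdifferentiableWithinAt_univ] at this
    have hψ : MDifferentiableAt 𝓘(ℝ, E') 𝓘(ℝ, E') ψ (f (φ.symm z)) :=
      mdifferentiableAt_extChartAt (by rw [← extChartAt_source 𝓘(ℝ, E')]; exact h2)
    have h3 := (hψ.hasMFDerivAt.comp _ (hf (φ.symm z))).comp z hφ.hasMFDerivAt
    rw [ContinuousLinearMap.comp_zero, ContinuousLinearMap.zero_comp] at h3
    exact h3.hasFDerivAt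
  have hconst : ∀ z ∈ Metric.ball (φ x) r, (ψ ∘ f ∘ φ.symm) z = (ψ ∘ f ∘ φ.symm) (φ x) := by
    intro z hz
    refine (convex_ball (φ x) r).is_const_of_fderivWithin_eq_zero (𝕜 := ℝ)
      (fun z hz => (hd z hz).differentiableAt.differentiableWithinAt) (fun z hz => ?_) hz
      (Metric.mem_ball_self hr)
    exact (hd z hz).hasFDerivWithinAt.fderivWithin (Metric.isOpen_ball.uniqueDiffWithinAt hz)
  filter_upwards [(continuousAt_extChartAt (I := 𝓘(ℝ, E)) x).preimage_mem_nhds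
    (Metric.ball_mem_nhds _ hr), extChartAt_source_mem_nhds (I := 𝓘(ℝ, E)) x] with y hy hys
  have h1 := hconst _ hy
  simp only [Function.comp_apply] at h1
  have h2 := (hball hy).2
  rw [Set.mem_preimage, Set.mem_preimage] at h2
  rw [φ.left_inv hys] at h1 h2
  rw [φ.left_inv (mem_extChartAt_source x)] at h1
  exact ψ.injOn h2 (mem_extChartAt_source (f x)) h1

theorem eq_of_hasMFDerivAt_zero [PreconnectedSpace M] {f : M → N}
    (hf : ∀ x, HasMFDerivAt 𝓘(ℝ, E) 𝓘(ℝ, E') f x 0) (x y : M) : f x = f y :=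
  (isLocallyConstant_of_hasMFDerivAt_zero hf).apply_eq_of_preconnectedSpace x y

end LocallyConstant

/-! ### Differentials of automorphisms -/

section Differential

variable {E : Type*} [NormedAddCommGroup E] [NormedSpace ℝ E]
  {G : Type*} [TopologicalSpace G] [ChartedSpace E G] [Group G] [LieGroup 𝓘(ℝ, E) ∞ G]

theorem contMDiff_conj (y : G) :
    ContMDiff 𝓘(ℝ, E) 𝓘(ℝ, E) ∞ (fun x : G => MulAut.conj y x) := by
  simp only [MulAut.conj_apply]
  exact (contMDiff_mul_right (a := y⁻¹)).comp (contMDiff_mul_left (a := y))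

omit [LieGroup 𝓘(ℝ, E) ∞ G] in
theorem differential_mul {t t' : MulAut G}
    (ht : ContMDiff 𝓘(ℝ, E) 𝓘(ℝ, E) ∞ (fun x : G => t x))
    (ht' : ContMDiff 𝓘(ℝ, E) 𝓘(ℝ, E) ∞ (fun x : G => t' x)) :
    differential E (t * t') = differential E t ∘ₗ differential E t' := by
  ext v
  have h := mfderiv_comp_apply_of_eq (I := 𝓘(ℝ, E)) (I' := 𝓘(ℝ, E)) (I'' := 𝓘(ℝ, E))
    (f := fun x : G => t' x) (g := fun x : G => t x)
    (x := 1) (y := 1) (ht.mdifferentiableAt (by simp)) (ht'.mdifferentiableAt (by simp))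
    (map_one t') v
  exact h

omit [LieGroup 𝓘(ℝ, E) ∞ G] in
theorem differential_one : differential E (1 : MulAut G) = LinearMap.id := by
  ext v
  exact congrArg (fun L : E →L[ℝ] E => L v) (mfderiv_id (I := 𝓘(ℝ, E)) (x := (1 : G)))

end Differential

section Differential

variable {E : Type*} [NormedAddCommGroup E] [NormedSpace ℝ E]
  {G : Type*} [TopologicalSpace G] [ChartedSpace E G] [Group G] [LieGroup 𝓘(ℝ, E) ∞ G]

/-- An automorphism of a connected Lie group is determined by its differential. -/
theorem eq_one_of_differential_eq_id [ConnectedSpace G] {t : MulAut G}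
    (ht : ContMDiff 𝓘(ℝ, E) 𝓘(ℝ, E) ∞ (fun x : G => t x))
    (hd : differential E t = LinearMap.id) : t = 1 := by
  have : IsManifold 𝓘(ℝ, E) 1 G := IsManifold.of_le (n := ∞) (by simp)
  let P : G × G → G := fun p => p.1 * p.2⁻¹
  have hP : ContMDiff (𝓘(ℝ, E).prod 𝓘(ℝ, E)) 𝓘(ℝ, E) ∞ P :=
    contMDiff_fst.mul contMDiff_snd.inv
  have hP1 : MDifferentiableAt (𝓘(ℝ, E).prod 𝓘(ℝ, E)) 𝓘(ℝ, E) P (1, 1) :=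
    hP.mdifferentiableAt (by simp)
  -- As `t` has differential `id`, the chain rule gives the same derivative as for the constant `x *
  -- x⁻¹`; inversion need not be differentiated.
  have hf1 : HasMFDerivAt 𝓘(ℝ, E) 𝓘(ℝ, E) (fun x : G => t x * x⁻¹) 1 0 := by
    have htd : HasMFDerivAt 𝓘(ℝ, E) 𝓘(ℝ, E) (fun x : G => t x) 1
        (ContinuousLinearMap.id ℝ E : E →L[ℝ] E) := by
      have h1 := (ht.mdifferentiableAt (by simp) (x := 1)).hasMFDerivAt
      have h2 : (mfderiv 𝓘(ℝ, E) 𝓘(ℝ, E) (fun x : G => t x) 1 : E →L[ℝ] E) =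
          ContinuousLinearMap.id ℝ E := by
        ext v
        exact LinearMap.congr_fun hd v
      exact h2 ▸ h1
    have hid := hasMFDerivAt_id (I := 𝓘(ℝ, E)) (1 : G)
    have hpair := htd.prodMk hid
    have hdiag := hid.prodMk hid
    have h3 : HasMFDerivAt (𝓘(ℝ, E).prod 𝓘(ℝ, E)) 𝓘(ℝ, E) P (t 1, 1)
        (mfderiv (𝓘(ℝ, E).prod 𝓘(ℝ, E)) 𝓘(ℝ, E) P (1, 1) : E × E →L[ℝ] E) := by
      rw [map_one]
      exact hP1.hasMFDerivAt
    have h4 := HasMFDerivAt.comp (f := fun x : G => (t x, id x)) (g := P) 1 h3 hpair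
    have h5 := HasMFDerivAt.comp (f := fun x : G => (id x, id x)) (g := P) 1 hP1.hasMFDerivAt hdiag
    have h6 : HasMFDerivAt 𝓘(ℝ, E) 𝓘(ℝ, E) (P ∘ fun x : G => (id x, id x)) 1
        (0 : E →L[ℝ] E) := by
      have : (P ∘ fun x : G => (id x, id x)) = fun _ => 1 := by ext x; simp [P]
      rw [this]
      exact hasMFDerivAt_const 1 1
    have h7 := hasMFDerivAt_unique h5 h6
    exact h7 ▸ h4
  -- With `f z = t z * z⁻¹` one has `f z = t x * f (x⁻¹ * z) * x⁻¹`, which reduces to the identity.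
  have hf : ∀ x : G, HasMFDerivAt 𝓘(ℝ, E) 𝓘(ℝ, E) (fun x : G => t x * x⁻¹) x 0 := by
    intro x
    have h1 : HasMFDerivAt 𝓘(ℝ, E) 𝓘(ℝ, E) (fun x : G => t x * x⁻¹) (x⁻¹ * x) 0 := by
      rw [inv_mul_cancel]; exact hf1
    have h2 := ((contMDiff_mul_left (I := 𝓘(ℝ, E)) (n := ∞) (a := x⁻¹)).mdifferentiableAt
      (by simp) (x := x)).hasMFDerivAt
    have hout : ContMDiff 𝓘(ℝ, E) 𝓘(ℝ, E) ∞ (fun z : G => t x * z * x⁻¹) :=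
      (contMDiff_mul_right (a := x⁻¹)).comp (contMDiff_mul_left (a := t x))
    have h3 := ((hout.mdifferentiableAt (by simp)).hasMFDerivAt).comp x (h1.comp x h2)
    rw [ContinuousLinearMap.zero_comp, ContinuousLinearMap.comp_zero] at h3
    refine h3.congr_of_eventuallyEq (Filter.Eventually.of_forall fun z => ?_)
    simp [mul_assoc]
  ext x
  have := eq_of_hasMFDerivAt_zero hf x 1
  simp only [map_one, inv_one, mul_one] at this
  rwa [mul_inv_eq_one] at this

/-- A one-parameter subgroup with vanishing velocity is trivial. -/
theorem oneParameterSubgroup_eq_one {c : ℝ → G} (hc : ContMDiff 𝓘(ℝ, ℝ) 𝓘(ℝ, E) ∞ c)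
    (hadd : ∀ s t : ℝ, c (s + t) = c s * c t)
    (h0 : (mfderiv 𝓘(ℝ, ℝ) 𝓘(ℝ, E) c 0 (1 : ℝ) : E) = 0) (s : ℝ) : c s = 1 := by
  have : IsManifold 𝓘(ℝ, E) 1 G := IsManifold.of_le (n := ∞) (by simp)
  have hc0 : HasMFDerivAt 𝓘(ℝ, ℝ) 𝓘(ℝ, E) c 0 (0 : ℝ →L[ℝ] E) := by
    have h1 := (hc.mdifferentiableAt (by simp) (x := 0)).hasMFDerivAt
    have h2 : (mfderiv 𝓘(ℝ, ℝ) 𝓘(ℝ, E) c 0 : ℝ →L[ℝ] E) = 0 := by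
      ext
      exact h0
    exact h2 ▸ h1
  -- Translation: `c r = c s * c (r - s)`.
  have hcs : ∀ s, HasMFDerivAt 𝓘(ℝ, ℝ) 𝓘(ℝ, E) c s 0 := by
    intro s
    have h1 : HasMFDerivAt 𝓘(ℝ, ℝ) 𝓘(ℝ, E) c (s - s) 0 := by
      rw [sub_self]; exact hc0
    have h2 : HasMFDerivAt 𝓘(ℝ, ℝ) 𝓘(ℝ, ℝ) (fun r : ℝ => r - s) s (ContinuousLinearMap.id ℝ ℝ) :=
      ((hasFDerivAt_id s).sub_const s).hasMFDerivAt
    have hout : ContMDiff 𝓘(ℝ, E) 𝓘(ℝ, E) ∞ (fun z : G => c s * z) := contMDiff_mul_left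
    have h3 := ((hout.mdifferentiableAt (by simp)).hasMFDerivAt).comp s
      (HasMFDerivAt.comp (f := fun r : ℝ => r - s) s h1 h2)
    have h4 := h3.congr_mfderiv (f₁' := 0) (ContinuousLinearMap.ext fun r =>
      ContinuousLinearMap.map_zero
        (mfderiv 𝓘(ℝ, E) 𝓘(ℝ, E) (fun z : G => c s * z) (c (s - s)) : E →L[ℝ] E))
    refine h4.congr_of_eventuallyEq (Filter.Eventually.of_forall fun r => ?_)
    simp [← hadd]
  have h1 : c 0 = 1 := by simpa using hadd 0 0
  rw [← h1]
  exact eq_of_hasMFDerivAt_zero hcs s 0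

/-- The differential of an involutive automorphism preserves Lie brackets. -/
theorem differential_lie [CompleteSpace E] {t : MulAut G}
    (ht : ContMDiff 𝓘(ℝ, E) 𝓘(ℝ, E) ∞ (fun x : G => t x)) (hinv : t * t = 1)
    (v w : GroupLieAlgebra 𝓘(ℝ, E) G) :
    differential E t ⁅v, w⁆ = ⁅differential E t v, differential E t w⁆ := by
  have hmd : ∀ x, MDifferentiableAt 𝓘(ℝ, E) 𝓘(ℝ, E) (fun x : G => t x) x :=
    fun x => ht.mdifferentiableAt (by simp)
  have htt : ∀ x, t (t x) = x := fun x => DFunLike.congr_fun hinv x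
  have hcompid : ∀ g : G, ∀ v : E, (mfderiv 𝓘(ℝ, E) 𝓘(ℝ, E) (fun x : G => t x) (t g) : E →L[ℝ] E)
      ((mfderiv 𝓘(ℝ, E) 𝓘(ℝ, E) (fun x : G => t x) g : E →L[ℝ] E) v) = v := by
    intro g v
    have h1 := mfderiv_comp_apply g (hmd (t g)) (hmd g) v
    have h2 : (fun x : G => t x) ∘ (fun x : G => t x) = id := by ext x; exact htt x
    rw [h2, mfderiv_id] at h1
    exact h1.symm
  have hinvert : ∀ g : G, (mfderiv 𝓘(ℝ, E) 𝓘(ℝ, E) (fun x : G => t x) g).IsInvertible := by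
    intro g
    refine ContinuousLinearMap.IsInvertible.of_inverse
      (g := (mfderiv 𝓘(ℝ, E) 𝓘(ℝ, E) (fun x : G => t x) (t g) : E →L[ℝ] E)) ?_ ?_
    · refine ContinuousLinearMap.ext fun v => ?_
      have hx : ∀ x, x = t (t g) → (mfderiv 𝓘(ℝ, E) 𝓘(ℝ, E) (fun x : G => t x) x : E →L[ℝ] E)
          ((mfderiv 𝓘(ℝ, E) 𝓘(ℝ, E) (fun x : G => t x) (t g) : E →L[ℝ] E) v) = v := by
        rintro _ rfl
        exact hcompid (t g) v
      exact hx g (htt g).symm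
    · exact ContinuousLinearMap.ext fun v => hcompid g v
  -- From `t (g * x) = t g * t x`, left-invariant fields pull back to left-invariant fields;
  -- naturality of the bracket then concludes.
  have hpull : ∀ v : GroupLieAlgebra 𝓘(ℝ, E) G,
      VectorField.mpullback 𝓘(ℝ, E) 𝓘(ℝ, E) (fun x : G => t x)
        (mulInvariantVectorField (differential E t v)) = mulInvariantVectorField v := by
    intro v
    ext g
    rw [VectorField.mpullback_apply]
    have h1 := mfderiv_comp_apply_of_eq (I := 𝓘(ℝ, E)) (I' := 𝓘(ℝ, E)) (I'' := 𝓘(ℝ, E))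
      (f := fun x : G => g * x) (g := fun x : G => t x) (x := 1) (y := g)
      (hmd g) (contMDiff_mul_left.mdifferentiableAt (n := ∞) (by simp)) (mul_one g) v
    have h2 := mfderiv_comp_apply_of_eq (I := 𝓘(ℝ, E)) (I' := 𝓘(ℝ, E)) (I'' := 𝓘(ℝ, E))
      (f := fun x : G => t x) (g := fun x : G => t g * x) (x := 1) (y := 1)
      (contMDiff_mul_left.mdifferentiableAt (n := ∞) (by simp)) (hmd 1) (map_one t) v
    have h3 : (fun x : G => t x) ∘ (fun x : G => g * x) =
        (fun x : G => t g * x) ∘ (fun x : G => t x) := by ext x; simp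
    rw [h3] at h1
    have h4 := h2.symm.trans h1
    have h5 : mulInvariantVectorField (differential E t v) (t g) =
        (mfderiv 𝓘(ℝ, E) 𝓘(ℝ, E) (fun x : G => t x) g) (mulInvariantVectorField v g) := h4
    rw [h5]
    exact (hinvert g).inverse_apply_eq.2 rfl
  have key := VectorField.mpullback_mlieBracket (I := 𝓘(ℝ, E)) (I' := 𝓘(ℝ, E)) (n := ∞)
    (f := fun x : G => t x) (x₀ := 1)
    (mdifferentiableAt_mulInvariantVectorField (I := 𝓘(ℝ, E)) (differential E t v) (g := t 1))
    (mdifferentiableAt_mulInvariantVectorField (differential E t w) (g := t 1))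
    ht.contMDiffAt (by rw [minSmoothness_of_isRCLikeNormedField]; exact ENat.LEInfty.out)
  rw [hpull, hpull, VectorField.mpullback_apply, (hinvert 1).inverse_apply_eq] at key
  have hpt : ∀ x : G, x = 1 → ∀ V W : (x : G) → TangentSpace 𝓘(ℝ, E) x,
      (VectorField.mlieBracket 𝓘(ℝ, E) V W x : E) = VectorField.mlieBracket 𝓘(ℝ, E) V W 1 := by
    rintro _ rfl V W; rfl
  have h6 := (hpt (t 1) (map_one t) _ _).symm.trans key
  exact h6.symm

end Differential

/-! ### The Lie bracket in the chart at the identity -/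

section Adjoint

variable {E : Type*} [NormedAddCommGroup E] [NormedSpace ℝ E]
  {G : Type*} [TopologicalSpace G] [ChartedSpace E G] [Group G] [LieGroup 𝓘(ℝ, E) ∞ G]

variable (E G) in
/-- The chart of `G` at the identity. -/
noncomputable abbrev chartOne : PartialEquiv G E := extChartAt 𝓘(ℝ, E) (1 : G)

variable (E G) in
/-- The multiplication of `G` in the chart at the identity. -/
noncomputable def chartMul (p : E × E) : E :=
  chartOne E G ((chartOne E G).symm p.1 * (chartOne E G).symm p.2)

omit [LieGroup 𝓘(ℝ, E) ∞ G] in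
theorem chartOne_symm_one : (chartOne E G).symm (chartOne E G 1) = 1 := extChartAt_to_inv 1

theorem contMDiffAt_chartOne_symm :
    ContMDiffAt 𝓘(ℝ, E) 𝓘(ℝ, E) ∞ (chartOne E G).symm (chartOne E G 1) :=
  (contMDiffOn_extChartAt_symm 1).contMDiffAt (extChartAt_target_mem_nhds 1)

theorem contDiffAt_chartMul :
    ContDiffAt ℝ 2 (chartMul E G) (chartOne E G 1, chartOne E G 1) := by
  have h1 : ContMDiffAt 𝓘(ℝ, E × E) 𝓘(ℝ, E) ∞
      (fun p : E × E => (chartOne E G).symm p.1 * (chartOne E G).symm p.2)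
      (chartOne E G 1, chartOne E G 1) :=
    (ContMDiffAt.comp (f := Prod.fst) (chartOne E G 1, chartOne E G 1) contMDiffAt_chartOne_symm
      contDiff_fst.contMDiff.contMDiffAt).mul
    (ContMDiffAt.comp (f := Prod.snd) (chartOne E G 1, chartOne E G 1) contMDiffAt_chartOne_symm
      contDiff_snd.contMDiff.contMDiffAt)
  have h2 : ContMDiffAt 𝓘(ℝ, E) 𝓘(ℝ, E) ∞ (chartOne E G)
      ((chartOne E G).symm (chartOne E G 1) * (chartOne E G).symm (chartOne E G 1)) := by
    rw [chartOne_symm_one, mul_one]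
    exact contMDiffAt_extChartAt
  have h3 := h2.comp (chartOne E G 1, chartOne E G 1) h1
  exact (contMDiffAt_iff_contDiffAt.1 h3).of_le ENat.LEInfty.out

theorem eventually_differentiableAt_chartMul :
    ∀ᶠ p in nhds (chartOne E G 1, chartOne E G 1), DifferentiableAt ℝ (chartMul E G) p := by
  filter_upwards [contDiffAt_chartMul.eventually (by simp)] with p hp
  exact hp.differentiableAt (by simp)

omit [LieGroup 𝓘(ℝ, E) ∞ G] in
theorem hasFDerivAt_chartMul_left {x y : E} (h : DifferentiableAt ℝ (chartMul E G) (x, y)) :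
    HasFDerivAt (fun x => chartMul E G (x, y))
      ((fderiv ℝ (chartMul E G) (x, y)).comp (ContinuousLinearMap.inl ℝ E E)) x :=
  HasFDerivAt.comp (g := chartMul E G) (f := fun x => (x, y)) x h.hasFDerivAt
    (hasFDerivAt_prodMk_left x y)

omit [LieGroup 𝓘(ℝ, E) ∞ G] in
theorem hasFDerivAt_chartMul_right {x y : E} (h : DifferentiableAt ℝ (chartMul E G) (x, y)) :
    HasFDerivAt (fun y => chartMul E G (x, y))
      ((fderiv ℝ (chartMul E G) (x, y)).comp (ContinuousLinearMap.inr ℝ E E)) y :=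
  HasFDerivAt.comp (g := chartMul E G) (f := fun y => (x, y)) y h.hasFDerivAt
    (hasFDerivAt_prodMk_right x y)

/-- The derivative at the identity of a map is its derivative in the chart at the identity. -/
theorem hasFDerivAt_chart_comp {f : G → E} {f' : E →L[ℝ] E}
    (hf : HasMFDerivAt 𝓘(ℝ, E) 𝓘(ℝ, E) f 1 f') :
    HasFDerivAt (f ∘ (chartOne E G).symm) f' (chartOne E G 1) := by
  have : IsManifold 𝓘(ℝ, E) 1 G := IsManifold.of_le (n := ∞) (by simp)
  have h1 : HasMFDerivAt 𝓘(ℝ, E) 𝓘(ℝ, E) (chartOne E G).symm (chartOne E G 1)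
      (ContinuousLinearMap.id ℝ E : E →L[ℝ] E) := by
    have h2 := (contMDiffAt_chartOne_symm (E := E) (G := G)).mdifferentiableAt (by simp)
    have h3 := mfderivWithin_range_extChartAt_symm (I := 𝓘(ℝ, E)) (x := (1 : G))
    rw [modelWithCornersSelf_coe, Set.range_id, mfderivWithin_univ] at h3
    exact h2.hasMFDerivAt.congr_mfderiv h3
  have h4 : HasMFDerivAt 𝓘(ℝ, E) 𝓘(ℝ, E) f ((chartOne E G).symm (chartOne E G 1)) f' := by
    rw [chartOne_symm_one]; exact hf
  exact (h4.comp (chartOne E G 1) h1).hasFDerivAt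

/-- The left-invariant vector field of `w` in the chart at the identity. -/
noncomputable def chartField (w : GroupLieAlgebra 𝓘(ℝ, E) G) (x : E) : E :=
  VectorField.mpullback 𝓘(ℝ, E) 𝓘(ℝ, E) (chartOne E G).symm (mulInvariantVectorField w) x

/-- A left-invariant field is the derivative of the product in its second factor, here read in the
chart. -/
theorem chartField_eq {x : E} (hx : x ∈ (chartOne E G).target)
    (h : DifferentiableAt ℝ (chartMul E G) (x, chartOne E G 1)) (w : GroupLieAlgebra 𝓘(ℝ, E) G) :
    chartField w x = fderiv ℝ (chartMul E G) (x, chartOne E G 1) (0, w) := by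
  have : IsManifold 𝓘(ℝ, E) 1 G := IsManifold.of_le (n := ∞) (by simp)
  set k := (chartOne E G).symm x with hk
  have hks : k ∈ (chartAt E (1 : G)).source := by
    rw [← extChartAt_source 𝓘(ℝ, E)]
    exact (chartOne E G).map_target hx
  have h1 := (contMDiff_mul_left (I := 𝓘(ℝ, E)) (n := ∞) (a := k)).mdifferentiableAt
      (by simp) (x := 1) |>.hasMFDerivAt
  have h2 : HasMFDerivAt 𝓘(ℝ, E) 𝓘(ℝ, E) (chartOne E G) (k * 1)
      (mfderiv 𝓘(ℝ, E) 𝓘(ℝ, E) (chartOne E G) k : E →L[ℝ] E) := by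
    rw [mul_one]
    exact (mdifferentiableAt_extChartAt hks).hasMFDerivAt
  have h3 := hasFDerivAt_chart_comp (h2.comp 1 h1)
  have h4 := (hasFDerivAt_chartMul_right h).unique h3
  have h5 : fderiv ℝ (chartMul E G) (x, chartOne E G 1) (0, w) =
      (mfderiv 𝓘(ℝ, E) 𝓘(ℝ, E) (chartOne E G) k : E →L[ℝ] E)
        (mulInvariantVectorField w k : E) := DFunLike.congr_fun h4 w
  rw [h5]
  have h6 := isInvertible_mfderivWithin_extChartAt_symm (I := 𝓘(ℝ, E)) hx
  have h7 := mfderivWithin_extChartAt_symm_comp_mfderiv_extChartAt (I := 𝓘(ℝ, E)) hx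
  rw [modelWithCornersSelf_coe, Set.range_id, mfderivWithin_univ] at h6 h7
  exact h6.inverse_apply_eq.2 (DFunLike.congr_fun h7 (mulInvariantVectorField w k)).symm

omit [LieGroup 𝓘(ℝ, E) ∞ G] in
theorem chartMul_one_left :
    ∀ᶠ y in nhds (chartOne E G 1), chartMul E G (chartOne E G 1, y) = y := by
  filter_upwards [extChartAt_target_mem_nhds (I := 𝓘(ℝ, E)) (1 : G)] with y hy
  rw [chartMul, chartOne_symm_one, one_mul]
  exact (chartOne E G).right_inv hy

omit [LieGroup 𝓘(ℝ, E) ∞ G] in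
theorem chartMul_one_right :
    ∀ᶠ x in nhds (chartOne E G 1), chartMul E G (x, chartOne E G 1) = x := by
  filter_upwards [extChartAt_target_mem_nhds (I := 𝓘(ℝ, E)) (1 : G)] with y hy
  rw [chartMul, chartOne_symm_one, mul_one]
  exact (chartOne E G).right_inv hy

theorem fderiv_chartMul_one_inr :
    (fderiv ℝ (chartMul E G) (chartOne E G 1, chartOne E G 1)).comp
      (ContinuousLinearMap.inr ℝ E E) = ContinuousLinearMap.id ℝ E := by
  have h1 := hasFDerivAt_chartMul_right
    (eventually_differentiableAt_chartMul (E := E) (G := G)).self_of_nhds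
  exact h1.unique ((hasFDerivAt_id _).congr_of_eventuallyEq chartMul_one_left)

theorem fderiv_chartMul_one_inl :
    (fderiv ℝ (chartMul E G) (chartOne E G 1, chartOne E G 1)).comp
      (ContinuousLinearMap.inl ℝ E E) = ContinuousLinearMap.id ℝ E := by
  have h1 := hasFDerivAt_chartMul_left
    (eventually_differentiableAt_chartMul (E := E) (G := G)).self_of_nhds
  exact h1.unique ((hasFDerivAt_id _).congr_of_eventuallyEq chartMul_one_right)

theorem hasFDerivAt_fderiv_chartMul :
    HasFDerivAt (fderiv ℝ (chartMul E G))
      (fderiv ℝ (fderiv ℝ (chartMul E G)) (chartOne E G 1, chartOne E G 1))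
      (chartOne E G 1, chartOne E G 1) :=
  ((contDiffAt_chartMul.fderiv_right (m := 1) (by norm_num)).differentiableAt
    (by simp)).hasFDerivAt

theorem chartField_one (w : GroupLieAlgebra 𝓘(ℝ, E) G) : chartField w (chartOne E G 1) = w := by
  rw [chartField_eq (mem_extChartAt_target 1)
    (eventually_differentiableAt_chartMul (E := E) (G := G)).self_of_nhds]
  exact DFunLike.congr_fun (fderiv_chartMul_one_inr (E := E) (G := G)) w

theorem hasFDerivAt_chartField (w : GroupLieAlgebra 𝓘(ℝ, E) G) :
    HasFDerivAt (chartField w)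
      (((fderiv ℝ (fderiv ℝ (chartMul E G)) (chartOne E G 1, chartOne E G 1)).flip
        ((0, w) : E × E)).comp (ContinuousLinearMap.inl ℝ E E)) (chartOne E G 1) := by
  have h1 := HasFDerivAt.comp (f := fun x : E => (x, chartOne E G 1)) (chartOne E G 1)
    (hasFDerivAt_fderiv_chartMul (E := E) (G := G))
    (hasFDerivAt_prodMk_left (𝕜 := ℝ) (chartOne E G 1) (chartOne E G 1))
  have h2 := h1.clm_apply (hasFDerivAt_const ((0, w) : E × E) (chartOne E G 1))
  have h3 := h2.congr_fderiv (f' := _) (g' :=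
    ((fderiv ℝ (fderiv ℝ (chartMul E G)) (chartOne E G 1, chartOne E G 1)).flip
      ((0, w) : E × E)).comp (ContinuousLinearMap.inl ℝ E E)) (by
        refine ContinuousLinearMap.ext fun v => ?_
        simp)
  refine h3.congr_of_eventuallyEq ?_
  have h4 : Filter.Tendsto (fun x : E => (x, chartOne E G 1)) (nhds (chartOne E G 1))
      (nhds (chartOne E G 1, chartOne E G 1)) :=
    (Continuous.prodMk_left _).continuousAt
  filter_upwards [extChartAt_target_mem_nhds (I := 𝓘(ℝ, E)) (1 : G),
    h4.eventually eventually_differentiableAt_chartMul] with x hx hx'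
  exact chartField_eq hx hx' w

/-- The Lie bracket in terms of the second derivative of the multiplication. -/
theorem lie_eq_chart (v w : GroupLieAlgebra 𝓘(ℝ, E) G) :
    (⁅v, w⁆ : GroupLieAlgebra 𝓘(ℝ, E) G) =
      fderiv ℝ (fderiv ℝ (chartMul E G)) (chartOne E G 1, chartOne E G 1)
        ((v, 0) : E × E) ((0, w) : E × E) -
      fderiv ℝ (fderiv ℝ (chartMul E G)) (chartOne E G 1, chartOne E G 1)
        ((w, 0) : E × E) ((0, v) : E × E) := by
  have : IsManifold 𝓘(ℝ, E) 1 G := IsManifold.of_le (n := ∞) (by simp)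
  have h1 : ⁅v, w⁆ = (ContinuousLinearMap.inverse
      (mfderiv 𝓘(ℝ, E) 𝓘(ℝ, E) (chartOne E G) 1 : E →L[ℝ] E) : E →L[ℝ] E)
      (VectorField.lieBracketWithin (E := E) ℝ
        (VectorField.mpullbackWithin 𝓘(ℝ, E) 𝓘(ℝ, E) (chartOne E G).symm
          (mulInvariantVectorField v) (Set.range 𝓘(ℝ, E)))
        (VectorField.mpullbackWithin 𝓘(ℝ, E) 𝓘(ℝ, E) (chartOne E G).symm
          (mulInvariantVectorField w) (Set.range 𝓘(ℝ, E)))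
        ((chartOne E G).symm ⁻¹' Set.univ ∩ Set.range 𝓘(ℝ, E)) (chartOne E G 1)) := by
    rw [GroupLieAlgebra.bracket_def, ← VectorField.mlieBracketWithin_univ,
      VectorField.mlieBracketWithin_apply]
    rfl
  have h2 : (mfderiv 𝓘(ℝ, E) 𝓘(ℝ, E) (chartOne E G) 1 : E →L[ℝ] E) =
      ContinuousLinearMap.id ℝ E := mfderiv_extChartAt_self (I := 𝓘(ℝ, E)) (x := (1 : G))
  rw [h2, ContinuousLinearMap.inverse_id, modelWithCornersSelf_coe, Set.range_id,
    Set.preimage_univ, Set.univ_inter, VectorField.mpullbackWithin_univ,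
    VectorField.mpullbackWithin_univ] at h1
  have h3 : ⁅v, w⁆ = VectorField.lieBracket ℝ (chartField v) (chartField w) (chartOne E G 1) := by
    rw [← VectorField.lieBracketWithin_univ]
    exact h1
  have h4 : VectorField.lieBracket ℝ (chartField v) (chartField w) (chartOne E G 1) =
      fderiv ℝ (chartField w) (chartOne E G 1) (chartField v (chartOne E G 1)) -
        fderiv ℝ (chartField v) (chartOne E G 1) (chartField w (chartOne E G 1)) := rfl
  rw [(hasFDerivAt_chartField v).fderiv, (hasFDerivAt_chartField w).fderiv, chartField_one,
    chartField_one] at h4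
  exact h3.trans h4

end Adjoint

/-! ### The derivative of the adjoint action -/

section Adjoint

variable {E : Type*} [NormedAddCommGroup E] [NormedSpace ℝ E]
  {G : Type*} [TopologicalSpace G] [ChartedSpace E G] [Group G] [LieGroup 𝓘(ℝ, E) ∞ G]

variable (E) in
/-- The adjoint action of `y : G` on the tangent space at the identity. -/
noncomputable def adjointCLM (y : G) : E →L[ℝ] E :=
  mfderiv 𝓘(ℝ, E) 𝓘(ℝ, E) (fun x : G => MulAut.conj y x) 1

theorem hasFDerivAt_conj_chart (y : G) :
    HasFDerivAt (fun h => chartOne E G (MulAut.conj y ((chartOne E G).symm h))) (adjointCLM E y)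
      (chartOne E G 1) := by
  have : IsManifold 𝓘(ℝ, E) 1 G := IsManifold.of_le (n := ∞) (by simp)
  have h1 : HasMFDerivAt 𝓘(ℝ, E) 𝓘(ℝ, E) (chartOne E G) (MulAut.conj y 1)
      (ContinuousLinearMap.id ℝ E : E →L[ℝ] E) := by
    rw [map_one]
    exact (mdifferentiableAt_extChartAt (mem_chart_source E 1)).hasMFDerivAt.congr_mfderiv
      (mfderiv_extChartAt_self (I := 𝓘(ℝ, E)))
  have h2 := ((contMDiff_conj (E := E) y).mdifferentiableAt (by simp) (x := 1)).hasMFDerivAt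
  exact hasFDerivAt_chart_comp
    (HasMFDerivAt.comp (f := fun x : G => MulAut.conj y x) (g := chartOne E G) 1 h1 h2)

/-- This differentiates `(y h y⁻¹) y = y h` at `h = 1` in the chart, avoiding the inverse of `y`. -/
theorem adjointCLM_comp {y : G} (hy : y ∈ (chartOne E G).source)
    (hl : DifferentiableAt ℝ (chartMul E G) (chartOne E G 1, chartOne E G y))
    (hr : DifferentiableAt ℝ (chartMul E G) (chartOne E G y, chartOne E G 1)) :
    ((fderiv ℝ (chartMul E G) (chartOne E G 1, chartOne E G y)).comp
      (ContinuousLinearMap.inl ℝ E E)).comp (adjointCLM E y) =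
    (fderiv ℝ (chartMul E G) (chartOne E G y, chartOne E G 1)).comp
      (ContinuousLinearMap.inr ℝ E E) := by
  set k : E → E := fun h => chartOne E G (MulAut.conj y ((chartOne E G).symm h)) with hk
  have hk1 : k (chartOne E G 1) = chartOne E G 1 := by
    simp only [hk, chartOne_symm_one, map_one]
  have h1 : HasFDerivAt (fun x => chartMul E G (x, chartOne E G y))
      ((fderiv ℝ (chartMul E G) (chartOne E G 1, chartOne E G y)).comp
        (ContinuousLinearMap.inl ℝ E E)) (k (chartOne E G 1)) := by
    rw [hk1]
    exact hasFDerivAt_chartMul_left hl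
  have h2 := h1.comp (chartOne E G 1) (hasFDerivAt_conj_chart y)
  have h3 := hasFDerivAt_chartMul_right hr
  refine h2.unique (h3.congr_of_eventuallyEq ?_)
  have hcont : ContinuousAt (fun h => MulAut.conj y ((chartOne E G).symm h)) (chartOne E G 1) :=
    ContinuousAt.comp (contMDiff_conj (E := E) y).continuous.continuousAt
      (contMDiffAt_chartOne_symm (E := E) (G := G)).continuousAt
  have hnhds : (chartOne E G).source ∈
      nhds (MulAut.conj y ((chartOne E G).symm (chartOne E G 1))) := by
    rw [chartOne_symm_one, map_one]
    exact extChartAt_source_mem_nhds 1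
  filter_upwards [hcont.preimage_mem_nhds hnhds] with h hh
  simp only [Function.comp_apply, hk, chartMul]
  rw [(chartOne E G).left_inv hh, (chartOne E G).left_inv hy]
  simp

/-- The derivative of the adjoint action along a one-parameter subgroup is the Lie bracket. -/
theorem hasDerivAt_adjointCLM [CompleteSpace E] {c : ℝ → G}
    (hc : ContMDiff 𝓘(ℝ, ℝ) 𝓘(ℝ, E) ∞ c) (hc0 : c 0 = 1) {Y : GroupLieAlgebra 𝓘(ℝ, E) G}
    (hY : (mfderiv 𝓘(ℝ, ℝ) 𝓘(ℝ, E) c 0 (1 : ℝ) : E) = Y) :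
    ∃ A : E →L[ℝ] E, (∀ w : GroupLieAlgebra 𝓘(ℝ, E) G, A w = ⁅Y, w⁆) ∧
      HasDerivAt (fun s => adjointCLM E (c s)) A 0 := by
  have : IsManifold 𝓘(ℝ, E) 1 G := IsManifold.of_le (n := ∞) (by simp)
  set e : E := chartOne E G 1
  set D := fderiv ℝ (fderiv ℝ (chartMul E G)) (e, e)
  let Y' : E := Y
  let γ : ℝ → E := fun s => chartOne E G (c s)
  have hγ0 : γ 0 = e := by simp only [γ, hc0, e]
  have hγ : HasDerivAt γ Y' 0 := by
    have h1 : HasMFDerivAt 𝓘(ℝ, E) 𝓘(ℝ, E) (chartOne E G) (c 0)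
        (ContinuousLinearMap.id ℝ E : E →L[ℝ] E) := by
      rw [hc0]
      exact (mdifferentiableAt_extChartAt (mem_chart_source E 1)).hasMFDerivAt.congr_mfderiv
        (mfderiv_extChartAt_self (I := 𝓘(ℝ, E)))
    have h2 := (hc.mdifferentiableAt (by simp) (x := 0)).hasMFDerivAt
    have h3 : HasFDerivAt γ ((ContinuousLinearMap.id ℝ E).comp
        (mfderiv 𝓘(ℝ, ℝ) 𝓘(ℝ, E) c 0 : ℝ →L[ℝ] E)) 0 := (h1.comp 0 h2).hasFDerivAt
    exact h3.hasDerivAt.congr_deriv hY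
  let P : ℝ → E →L[ℝ] E := fun s =>
    (fderiv ℝ (chartMul E G) (e, γ s)).comp (ContinuousLinearMap.inl ℝ E E)
  let Q : ℝ → E →L[ℝ] E := fun s =>
    (fderiv ℝ (chartMul E G) (γ s, e)).comp (ContinuousLinearMap.inr ℝ E E)
  have hD : HasFDerivAt (fderiv ℝ (chartMul E G)) D (e, e) := hasFDerivAt_fderiv_chartMul
  have hP : HasDerivAt P ((D (0, Y')).comp (ContinuousLinearMap.inl ℝ E E)) 0 := by
    have h1 : HasDerivAt (fun s => (e, γ s)) ((0 : E), Y') 0 := (hasDerivAt_const 0 e).prodMk hγ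
    have h2 : HasDerivAt (fun s => fderiv ℝ (chartMul E G) (e, γ s)) (D (0, Y')) 0 :=
      HasFDerivAt.comp_hasDerivAt (l := fderiv ℝ (chartMul E G)) (f := fun s => (e, γ s)) 0
        (by rw [hγ0]; exact hD) h1
    exact (h2.clm_comp (hasDerivAt_const 0 (ContinuousLinearMap.inl ℝ E E))).congr_deriv (by simp)
  have hQ : HasDerivAt Q ((D (Y', 0)).comp (ContinuousLinearMap.inr ℝ E E)) 0 := by
    have h1 : HasDerivAt (fun s => (γ s, e)) (Y', (0 : E)) 0 := hγ.prodMk (hasDerivAt_const 0 e)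
    have h2 : HasDerivAt (fun s => fderiv ℝ (chartMul E G) (γ s, e)) (D (Y', 0)) 0 :=
      HasFDerivAt.comp_hasDerivAt (l := fderiv ℝ (chartMul E G)) (f := fun s => (γ s, e)) 0
        (by rw [hγ0]; exact hD) h1
    exact (h2.clm_comp (hasDerivAt_const 0 (ContinuousLinearMap.inr ℝ E E))).congr_deriv (by simp)
  have hP0 : P 0 = 1 := by
    simp only [P, hγ0]
    exact fderiv_chartMul_one_inl
  have hQ0 : Q 0 = 1 := by
    simp only [Q, hγ0]
    exact fderiv_chartMul_one_inr
  -- Near `0` this gives `Ad (c s) = P⁻¹ Q` with `P 0 = Q 0 = 1`, so the derivative at `0` is `Q' -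
  -- P'`.
  have hPQ : ∀ᶠ s in nhds 0, P s * adjointCLM E (c s) = Q s := by
    have h1 : Filter.Tendsto (fun s => (e, γ s)) (nhds 0) (nhds (e, e)) := by
      have := (continuousAt_const (y := e)).prodMk hγ.continuousAt
      rwa [ContinuousAt, hγ0] at this
    have h2 : Filter.Tendsto (fun s => (γ s, e)) (nhds 0) (nhds (e, e)) := by
      have := hγ.continuousAt.prodMk (continuousAt_const (y := e))
      rwa [ContinuousAt, hγ0] at this
    have h3 : ∀ᶠ s in nhds 0, c s ∈ (chartOne E G).source := by
      refine hc.continuous.continuousAt.preimage_mem_nhds ?_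
      rw [hc0]
      exact extChartAt_source_mem_nhds 1
    filter_upwards [h3, h1.eventually eventually_differentiableAt_chartMul,
      h2.eventually eventually_differentiableAt_chartMul] with s hs hl hr
    exact adjointCLM_comp hs hl hr
  refine ⟨(D (Y', 0)).comp (ContinuousLinearMap.inr ℝ E E) -
    (D (0, Y')).comp (ContinuousLinearMap.inl ℝ E E), fun w => ?_, ?_⟩
  · rw [lie_eq_chart]
    -- Symmetry of the second derivative identifies `Q' - P'` with the bracket formula of
    -- `lie_eq_chart`.
    have hsymm : IsSymmSndFDerivAt ℝ (chartMul E G) (e, e) :=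
      (contDiffAt_chartMul (E := E) (G := G)).isSymmSndFDerivAt
        (by rw [minSmoothness_of_isRCLikeNormedField])
    exact congrArg (fun z : E => D (Y', 0) (0, w) - z) (hsymm (0, Y') (w, 0))
  · have hunit : ∀ᶠ s in nhds 0, IsUnit (P s) := by
      refine hP.continuousAt.preimage_mem_nhds (Units.isOpen.mem_nhds ?_)
      rw [hP0]
      exact isUnit_one
    have hinv : HasDerivAt (fun s => Ring.inverse (P s))
        (-((D (0, Y')).comp (ContinuousLinearMap.inl ℝ E E))) 0 := by
      have h1 : HasFDerivAt Ring.inverse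
          (-ContinuousLinearMap.mulLeftRight ℝ (E →L[ℝ] E) 1 1) (P 0) := by
        rw [hP0]
        simpa using hasFDerivAt_ringInverse (𝕜 := ℝ) (1 : (E →L[ℝ] E)ˣ)
      refine (h1.comp_hasDerivAt 0 hP).congr_deriv ?_
      simp
    have h2 := hinv.mul hQ
    refine (h2.congr_deriv ?_).congr_of_eventuallyEq ?_
    · rw [hP0, hQ0]
      simp
      abel
    · filter_upwards [hPQ, hunit] with s hs hu
      rw [Pi.mul_apply, ← hs, Ring.inverse_mul_cancel_left _ _ hu]

end Adjoint

/-! ### The adjoint action along one-parameter subgroups -/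

section OneParameterSubgroup

variable {E : Type*} [NormedAddCommGroup E] [NormedSpace ℝ E]
  {G : Type*} [TopologicalSpace G] [ChartedSpace E G] [Group G] [LieGroup 𝓘(ℝ, E) ∞ G]

theorem adjointCLM_mul (x y : G) : adjointCLM E (x * y) = adjointCLM E x * adjointCLM E y := by
  refine ContinuousLinearMap.ext fun w => ?_
  have h := differential_mul (contMDiff_conj (E := E) x) (contMDiff_conj (E := E) y)
  rw [← map_mul] at h
  exact LinearMap.congr_fun h w

omit [LieGroup 𝓘(ℝ, E) ∞ G] in
theorem adjointCLM_one : adjointCLM E (1 : G) = 1 := by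
  refine ContinuousLinearMap.ext fun w => ?_
  have h := differential_one (E := E) (G := G)
  rw [← map_one MulAut.conj] at h
  exact LinearMap.congr_fun h w

/-- The adjoint action of `exp (s Y)` is `exp (s ad Y)`. -/
theorem rotatesLike_differential_conj [CompleteSpace E] {c : ℝ → G}
    (hc : ContMDiff 𝓘(ℝ, ℝ) 𝓘(ℝ, E) ∞ c) (hadd : ∀ s t : ℝ, c (s + t) = c s * c t)
    {Y : GroupLieAlgebra 𝓘(ℝ, E) G}
    (hY : (mfderiv 𝓘(ℝ, ℝ) 𝓘(ℝ, E) c 0 (1 : ℝ) : E) = Y) (s : ℝ) :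
    RotatesLike Y s (differential E (MulAut.conj (c s))) := by
  have hc0 : c 0 = 1 := by simpa using hadd 0 0
  obtain ⟨A, hA, hd⟩ := hasDerivAt_adjointCLM hc hc0 hY
  intro u v r hu hv
  exact oneParameterGroup_rotation (V := E) hd
    (fun s t => by rw [hadd, adjointCLM_mul]) (by rw [hc0, adjointCLM_one])
    ((hA u).trans hu) ((hA v).trans hv) s

end OneParameterSubgroup

theorem mainTheorem9
    {E : Type*} [NormedAddCommGroup E] [NormedSpace ℝ E] [FiniteDimensional ℝ E]
    {G : Type*} [TopologicalSpace G] [ChartedSpace E G] [Group G] [LieGroup 𝓘(ℝ, E) ∞ G]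
    [T2Space G] [CompactSpace G] [ConnectedSpace G]
    (hsimple : LieAlgebra.IsSimple ℝ (GroupLieAlgebra 𝓘(ℝ, E) G))
    (B : LinearMap.BilinForm ℝ (GroupLieAlgebra 𝓘(ℝ, E) G)) (hB : IsInvariantInnerProduct B)
    (θ₁ θ₂ : MulAut G) (hθ₁ : IsInvolution E θ₁) (hθ₂ : IsInvolution E θ₂)
    (hcomm : Commute θ₁ θ₂)
    (a : Submodule ℝ (GroupLieAlgebra 𝓘(ℝ, E) G))
    (ha : IsMaximalAbelian (minusPart (differential E θ₁)) a)
    (Y : GroupLieAlgebra 𝓘(ℝ, E) G) (hY : Y ∈ a) (y : G) (hy : IsExp Y y)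
    (hconj : θ₂ = MulAut.conj y * θ₁ * (MulAut.conj y)⁻¹) :
    IsMaximalAbelian (minusPart (differential E θ₁) ⊓ minusPart (differential E θ₂)) a ∧
    Y ∈ latticeΓ B a (restrictedRoots B a) ∧
    IsTypeIV B a (triadOf B a (differential E θ₁) (differential E θ₂)) ∧
    IsTypeIVWith B a (triadOf B a (differential E θ₁) (differential E θ₂))
      (restrictedRoots B a) (restrictedMult B a) Y ∧
    (Y = 0 → θ₁ = θ₂ ∧
      (triadOf B a (differential E θ₁) (differential E θ₂)).tildeSigma = restrictedRoots B a ∧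
      (triadOf B a (differential E θ₁) (differential E θ₂)).sigma = restrictedRoots B a ∧
      (triadOf B a (differential E θ₁) (differential E θ₂)).w = ∅) := by

  obtain ⟨c, hc, hadd, hcY, rfl⟩ := hy
  have hc0 : c 0 = 1 := by simpa using hadd 0 0
  set t₁ := differential E θ₁ with ht₁
  set t₂ := differential E θ₂ with ht₂
  have hsq₁ : ∀ X, t₁ (t₁ X) = X := fun X => by
    have h1 := differential_mul hθ₁.contMDiff hθ₁.contMDiff
    rw [hθ₁.mul_self, differential_one] at h1
    exact (LinearMap.congr_fun h1 X).symm
  have hsq₂ : ∀ X, t₂ (t₂ X) = X := fun X => by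
    have h1 := differential_mul hθ₂.contMDiff hθ₂.contMDiff
    rw [hθ₂.mul_self, differential_one] at h1
    exact (LinearMap.congr_fun h1 X).symm
  have hcommd : ∀ X, t₁ (t₂ X) = t₂ (t₁ X) := fun X => by
    have h1 := differential_mul hθ₁.contMDiff hθ₂.contMDiff
    rw [hcomm.eq, differential_mul hθ₂.contMDiff hθ₁.contMDiff] at h1
    exact (LinearMap.congr_fun h1 X).symm
  have hpair : IsSymmetricPair B t₁ a :=
    { isSimple := hsimple
      inner := hB
      map_lie := differential_lie hθ₁.contMDiff hθ₁.mul_self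
      involutive := hsq₁
      ne_id := fun h => hθ₁.ne_one (eq_one_of_differential_eq_id hθ₁.contMDiff h)
      maximal := ha }
  have hR := rotatesLike_differential_conj hc hadd hcY 1
  have hR' := rotatesLike_differential_conj hc hadd hcY (-1)
  have hcinv : (MulAut.conj (c 1))⁻¹ = MulAut.conj (c (-1)) := by
    rw [← map_inv]
    congr 1
    rw [inv_eq_iff_mul_eq_one, ← hadd]
    simpa using hc0
  have ht : t₂ = differential E (MulAut.conj (c 1)) ∘ₗ t₁ ∘ₗ
      differential E (MulAut.conj (c (-1))) := by
    have hsm : ContMDiff 𝓘(ℝ, E) 𝓘(ℝ, E) ∞ (fun x : G => (MulAut.conj (c 1) * θ₁) x) :=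
      (contMDiff_conj (E := E) (c 1)).comp hθ₁.contMDiff
    rw [ht₂, hconj, hcinv, differential_mul hsm (contMDiff_conj (c (-1))),
      differential_mul (contMDiff_conj (c 1)) hθ₁.contMDiff, LinearMap.comp_assoc]
  have : FiniteDimensional ℝ (GroupLieAlgebra 𝓘(ℝ, E) G) :=
    inferInstanceAs (FiniteDimensional ℝ E)
  have hIV := hpair.isTypeIVWith hY hR hR' ht hsq₂ hcommd
  refine ⟨hpair.isMaximalAbelian_inf hY hR hR' ht, hIV.mem_lattice,
    ⟨restrictedMult B a, Y, hIV⟩, hIV, ?_⟩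
  rintro rfl
  -- Zero velocity makes the subgroup trivial, so the conjugation relating `θ₁` and `θ₂` is the
  -- identity.
  have hc1 : c 1 = 1 := oneParameterSubgroup_eq_one hc hadd hcY 1
  have hσ : sigmaAt B (restrictedRoots B a) 0 = restrictedRoots B a :=
    Set.Subset.antisymm (fun l hl => hl.1) fun l hl => ⟨hl, 0, by simp⟩
  refine ⟨?_, rfl, ?_, ?_⟩
  · rw [hconj, hc1, map_one, one_mul, inv_one, mul_one]
  · rw [hIV.sigma_eq, hσ]
  · rw [hIV.w_eq_diff, hσ, Set.sdiff_self]
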